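/- Let $d\ge 1$. Let $\mu$ be a measure on $(0,\infty)$ with $\int_{(0,\infty)}(1\wedge t)\,\mu(dt)<\infty$ and $\mu(0,\infty)=\infty$, and put $$\phi(\lambda)=\int_{(0,\infty)}(1-e^{-\lambda t})\,\mu(dt),\qquad \psi(\lambda)=\lambda+\phi(\lambda),\qquad H(\lambda)=\phi(\lambda)-\lambda\phi'(\lambda)\qquad(\lambda>0).$$ Then $\phi$ is a bijection of $(0,\infty)$ onto itself; $\phi^{-1}$ denotes its inverse. Let $S=(S_t)_{t\ge0}$ and $T=(T_t)_{t\ge0}$ be subordinators with Laplace exponents $\psi$ and $\phi$, that is, $\mathbb E e^{-\lambda S_t}=e^{-t\psi(\lambda)}$ and $\mathbb E e^{-\lambda T_t}=e^{-t\phi(\lambda)}$ for $\lambda>0$, $t\ge 0$. Let $W$ be a Brownian motion in $\mathbb R^d$ started at $0$ with transition density $p^{(2)}(t,x)=(4\pi t)^{-d/2}\exp(-|x|^2/(4t))$. Let $X_t=W_{S_t}$ with $W$ independent of $S$, and let $Y_t=W'_{T_t}$, where $W'$ is a Brownian motion with the same law as $W$ and independent of $T$. So $X$ is the subordinate Brownian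 motion with $\mathbb E e^{i\xi\cdot X_t}=e^{-t(|\xi|^2+\phi(|\xi|^2))}$. The transition densities of $X$ and $Y$ are, for $t>0$ and $x\in\mathbb R^d$, $$p(t,x)=\int_{(0,\infty)}(4\pi s)^{-d/2}e^{-|x|^2/(4s)}\,\mathbb P(S_t\in ds),\qquad q(t,x)=\int_{(0,\infty)}(4\pi s)^{-d/2}e^{-|x|^2/(4s)}\,\mathbb P(T_t\in ds);$$ that is, $X_t$ and $Y_t$ have laws $p(t,x)\,dx$ and $q(t,x)\,dx$. For $f:(0,\infty)\to(0,\infty)$ and $a\ge 0$ say that $f$ satisfies $L_a(\gamma,C_L)$, where $\gamma>0$ and $C_L\in(0,1]$, if $f(\lambda x)/f(\lambda)\ge C_L x^{\gamma}$ for all $\lambda>a$, $x\ge1$; and that $f$ satisfies $U_a(\delta,C_U)$, where $\delta>0$ and $C_U\in[1,\infty)$, if $f(\lambda x)/f(\lambda)\le C_U x^{\delta}$ for all $\lambda>a$, $x\ge1$. Write $u\wedge v=\min\{u,v\}$. **Theorem.** (1) Suppose that $H$ satisfies $L_a(\gamma,C_L)$ and $U_a(\delta,C_U)$ with $\delta<2$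 for some $a>0$. Then for all $T_0,M>0$ there are positive constants $c_1,\dots,c_5$ such that for all $0<t\le T_0$ and all $x\in\mathbb R^d$ with $|x|\le M/2$, $$c_1^{-1}\Big(t^{-d/2}\wedge\big(p^{(2)}(t,c_2x)+q(t,c_3x)\big)\Big)\le p(t,x)\le c_1\Big(t^{-d/2}\wedge\big(p^{(2)}(t,c_4x)+q(t,c_5x)\big)\Big).$$ (2) Suppose that $H$ satisfies $L_0(\gamma,C_L)$ and $U_0(\delta,C_U)$ with $\delta<2$. Then there are positive constants $c_6,\dots,c_{10}$ such that for all $t>0$ and all $x\in\mathbb R^d$, $$c_6^{-1}\Big(\big(t^{-d/2}\wedge\phi^{-1}(t^{-1})^{d/2}\big)\wedge\big(p^{(2)}(t,c_7x)+q(t,c_8x)\big)\Big)\le p(t,x)\le c_6\Big(\big(t^{-d/2}\wedge\phi^{-1}(t^{-1})^{d/2}\big)\wedge\big(p^{(2)}(t,c_9x)+q(t,c_{10}x)\big)\Big).$$ -/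

import Mathlib

open MeasureTheory ProbabilityTheory
open scoped NNReal ENNReal

/-- `d`-dimensional Euclidean space. -/
abbrev Euc (d : ℕ) : Type := EuclideanSpace ℝ (Fin d)

/-- The Gaussian kernel `p⁽²⁾(t, x) = (4πt)^{-d/2} exp(-|x|² / (4t))`. -/
noncomputable def gaussKernel {d : ℕ} (t : ℝ) (x : Euc d) : ℝ :=
  (4 * Real.pi * t) ^ (-(d : ℝ) / 2) * Real.exp (-‖x‖ ^ 2 / (4 * t))

/-- Brownian motion in `ℝ^d` started at the origin, running at twice the usual speed (generator
`Δ`): its increments over an interval of length `h` have density `gaussKernel h`. -/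
structure IsBrownianMotion {d : ℕ} {Ω : Type*} [MeasurableSpace Ω]
    (W : ℝ≥0 → Ω → Euc d) (P : Measure Ω) : Prop where
  measurable : ∀ t, Measurable (W t)
  zero : ∀ᵐ ω ∂P, W 0 ω = 0
  indep_increments : HasIndepIncrements W P
  law_increments : ∀ s t : ℝ≥0, s < t →
    HasLaw (fun ω => W t ω - W s ω)
      (volume.withDensity fun x => ENNReal.ofReal (gaussKernel ((t : ℝ) - s) x)) P
  continuous_paths : ∀ᵐ ω ∂P, Continuous fun t => W t ω

/-- A subordinator: an increasing Lévy process with values in `[0, ∞)`, started at `0`. -/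
structure IsSubordinator {Ω : Type*} [MeasurableSpace Ω]
    (S : ℝ≥0 → Ω → ℝ≥0) (P : Measure Ω) : Prop where
  measurable : ∀ t, Measurable (S t)
  zero : ∀ᵐ ω ∂P, S 0 ω = 0
  indep_increments : HasIndepIncrements (fun t ω => (S t ω : ℝ)) P
  stationary_increments : ∀ s t : ℝ≥0,
    IdentDistrib (fun ω => (S (s + t) ω : ℝ) - S s ω) (fun ω => (S t ω : ℝ)) P P
  monotone_paths : ∀ᵐ ω ∂P, Monotone fun t => S t ω
  rightContinuous_paths : ∀ᵐ ω ∂P, ∀ t, ContinuousWithinAt (fun s => S s ω) (Set.Ici t) t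

/-- `S` has Laplace exponent `ψ`: `E exp(-l S_t) = exp(-t ψ(l))` for all `l > 0`, `t ≥ 0`. -/
def HasLaplaceExponent {Ω : Type*} [MeasurableSpace Ω]
    (S : ℝ≥0 → Ω → ℝ≥0) (P : Measure Ω) (ψ : ℝ → ℝ) : Prop :=
  ∀ t : ℝ≥0, ∀ l : ℝ, 0 < l →
    ∫ ω, Real.exp (-l * (S t ω : ℝ)) ∂P = Real.exp (-(t : ℝ) * ψ l)

/-- `μ`, seen as a measure on `(0, ∞)`, is the Lévy measure of a subordinator. Everything below
uses only the restriction of `μ` to `(0, ∞)`. -/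
def IsSubordinatorLevyMeasure (μ : Measure ℝ) : Prop :=
  ∫⁻ t in Set.Ioi (0 : ℝ), ENNReal.ofReal (min 1 t) ∂μ < ∞

/-- The driftless Laplace exponent `φ(l) = ∫_{(0,∞)} (1 - e^{-lt}) μ(dt)`. -/
noncomputable def levyExponent (μ : Measure ℝ) (l : ℝ) : ℝ :=
  ∫ t in Set.Ioi (0 : ℝ), (1 - Real.exp (-l * t)) ∂μ

/-- The inverse of `φ : (0, ∞) → (0, ∞)`. If `μ(0,∞) = ∞`, then `φ` is a bijection of `(0, ∞)`
onto itself, so that this is its inverse at every `s > 0`. -/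
noncomputable def levyExponentInv (μ : Measure ℝ) (s : ℝ) : ℝ :=
  Function.invFunOn (levyExponent μ) (Set.Ioi 0) s

/-- `H(l) = φ(l) - l φ'(l)`. -/
noncomputable def levyH (μ : Measure ℝ) (l : ℝ) : ℝ :=
  levyExponent μ l - l * deriv (levyExponent μ) l

/-- The lower scaling condition `L_a(γ, C)`. -/
def LowerScaling (f : ℝ → ℝ) (a γ C : ℝ) : Prop :=
  0 ≤ a ∧ 0 < γ ∧ 0 < C ∧ C ≤ 1 ∧
    ∀ l x : ℝ, a < l → 1 ≤ x → C * x ^ γ ≤ f (l * x) / f l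

/-- The upper scaling condition `U_a(δ, C)`. -/
def UpperScaling (f : ℝ → ℝ) (a δ C : ℝ) : Prop :=
  0 ≤ a ∧ 0 < δ ∧ 1 ≤ C ∧
    ∀ l x : ℝ, a < l → 1 ≤ x → f (l * x) / f l ≤ C * x ^ δ

/-- The process `W` time-changed by `S`, that is `X_t = W_{S_t}`. -/
def subordinate {d : ℕ} {Ω : Type*} (W : ℝ≥0 → Ω → Euc d) (S : ℝ≥0 → Ω → ℝ≥0) :
    ℝ≥0 → Ω → Euc d :=
  fun t ω => W (S t ω) ω

/-- The pointwise version
`(t, x) ↦ ∫_{(0,∞)} (4πs)^{-d/2} exp(-|x|² / (4s)) P(S_t ∈ ds)`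
of the transition density of Brownian motion in `ℝ^d` subordinated by `S`. -/
noncomputable def subordinateDensity (d : ℕ) {Ω : Type*} [MeasurableSpace Ω]
    (S : ℝ≥0 → Ω → ℝ≥0) (P : Measure Ω) (t : ℝ≥0) (x : Euc d) : ℝ :=
  ∫ s in Set.Ioi (0 : ℝ), gaussKernel s x ∂(P.map fun ω => (S t ω : ℝ))

/-- `p` is a transition density of the process `X` with stationary independent increments started
at `0`: for every `t > 0` the law of `X_t` is `p(t, x) dx` (so that the process started at `x`
moves to `dy` with probability `p(t, y - x) dy`). -/
def IsTransitionDensity {d : ℕ} {Ω : Type*} [MeasurableSpace Ω]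
    (X : ℝ≥0 → Ω → Euc d) (P : Measure Ω) (p : ℝ≥0 → Euc d → ℝ) : Prop :=
  ∀ t : ℝ≥0, 0 < t →
    (∀ x, 0 ≤ p t x) ∧ HasLaw (X t) (volume.withDensity fun x => ENNReal.ofReal (p t x)) P

open Filter Topology Set

/-! The unit drift means that `S_t` has the law of `t + T_t`, since the Laplace transforms agree
(`measure_eq_of_laplace_eq`). Writing `g` for the Gaussian kernel, this gives `p(t,x) = E g(t + T_t,
x)` and `q(t,x) = E g(T_t, x)`, and the theorem compares two Gaussian mixtures.

Upper bounds. `g(t + s, x)` is at most a multiple of `t^(-d/2)`. As `t + s` lies between `max t s`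
and twice that, it is also at most `g(max t s, x/√2)`, hence at most the sum of the kernels at times
`t` and `s` (`integral_gaussKernel_add_le`). The bound by `φ⁻¹(1/t)^(d/2)` is a bound on `E
T_t^(-d/2)`, obtained from the Laplace transform and the lower scaling of `φ` inherited from `H`
(`lintegral_rpow_neg_le`, `lowerScaling_levyExponent`).

Lower bounds (`min_le_mul_integral_gaussKernel_add`). Let `T_t` lie in `[α, β]` with probability at
least `1/4`, where `t + β ≤ K (t + α)`, and put `r = t + α`. Then `p(t,x)` dominates `g(r,x)`. For
`|x|² ≤ 2dr` this is of order `r^(-d/2)`. For larger `x` the kernel increases in time up to `r`, so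
`g(r,x)` dominates the kernels at times `t` and `s ≤ r`, while for `s ≥ r` the times `s` and `t + s`
are comparable.

The window is `[0, Kt]` on bounded time intervals, because `φ(l)/l` decreases. Under global scaling
it surrounds `1/φ⁻¹(1/t)`, because Chebyshev bounds control both tails. -/

theorem one_sub_exp_neg_le_min (u : ℝ) : 1 - Real.exp (-u) ≤ min 1 u := by
  refine le_min (by linarith [Real.exp_pos (-u)]) ?_
  linarith [Real.add_one_le_exp (-u)]

theorem min_one_mul_le {l t : ℝ} (hl : 0 ≤ l) (ht : 0 ≤ t) :
    min 1 (l * t) ≤ (1 + l) * min 1 t := by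
  rcases le_total 1 t with h | h
  · rw [min_eq_left h]
    exact (min_le_left _ _).trans (by linarith)
  · rw [min_eq_right h]
    exact (min_le_right _ _).trans (by nlinarith)

theorem mul_exp_neg_le_one (u : ℝ) : u * Real.exp (-u) ≤ 1 := by
  have h := Real.add_one_le_exp u
  rw [Real.exp_neg, ← div_eq_mul_inv, div_le_one (Real.exp_pos u)]
  linarith

theorem mul_exp_neg_le_one_sub_exp_neg (u : ℝ) : u * Real.exp (-u) ≤ 1 - Real.exp (-u) := by
  have h := Real.add_one_le_exp u
  have h2 : (u + 1) * Real.exp (-u) ≤ 1 := by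
    rw [Real.exp_neg, ← div_eq_mul_inv, div_le_one (Real.exp_pos u)]
    exact h
  linarith

/-! ### Analysis of the exponent `φ` and of `H`. -/

namespace IsSubordinatorLevyMeasure

variable {μ : Measure ℝ}

theorem integrableOn_min (hμ : IsSubordinatorLevyMeasure μ) :
    IntegrableOn (fun t : ℝ => min 1 t) (Ioi 0) μ := by
  refine ⟨by fun_prop, ?_⟩
  rw [hasFiniteIntegral_iff_ofReal]
  · exact hμ
  · filter_upwards [self_mem_ae_restrict measurableSet_Ioi] with t ht
    exact le_min zero_le_one (le_of_lt ht)

theorem integrableOn_one_sub_exp (hμ : IsSubordinatorLevyMeasure μ) {l : ℝ} (hl : 0 ≤ l) :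
    IntegrableOn (fun t : ℝ => 1 - Real.exp (-l * t)) (Ioi 0) μ := by
  refine Integrable.mono' (hμ.integrableOn_min.const_mul (1 + l)) (by fun_prop) ?_
  filter_upwards [self_mem_ae_restrict measurableSet_Ioi] with t ht
  have ht' : (0 : ℝ) ≤ t := le_of_lt ht
  have h0 : 0 ≤ l * t := by positivity
  have h1 : Real.exp (-(l * t)) ≤ 1 := Real.exp_le_one_iff.2 (by linarith)
  rw [neg_mul, Real.norm_of_nonneg (by linarith)]
  exact (one_sub_exp_neg_le_min (l * t)).trans (min_one_mul_le hl ht')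

theorem levyExponent_nonneg (μ : Measure ℝ) {l : ℝ} (hl : 0 ≤ l) : 0 ≤ levyExponent μ l := by
  refine setIntegral_nonneg measurableSet_Ioi fun t ht => ?_
  have ht' : (0 : ℝ) ≤ t := le_of_lt ht
  have : Real.exp (-l * t) ≤ 1 := Real.exp_le_one_iff.2 (by nlinarith)
  linarith

theorem mul_exp_neg_bound {l t : ℝ} (hl : 0 < l) (ht : 0 < t) :
    t * Real.exp (-l * t) ≤ (1 + l⁻¹) * min 1 t := by
  have h1 : Real.exp (-l * t) ≤ 1 := Real.exp_le_one_iff.2 (by nlinarith)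
  have hl' : 0 < l⁻¹ := by positivity
  rcases le_total 1 t with h | h
  · rw [min_eq_left h]
    have := mul_exp_neg_le_one (l * t)
    have h2 : t * Real.exp (-l * t) = l⁻¹ * (l * t * Real.exp (-(l * t))) := by
      rw [neg_mul]; field_simp
    rw [h2]
    nlinarith
  · rw [min_eq_right h]
    nlinarith [mul_pos hl' ht]

theorem integrableOn_mul_exp (hμ : IsSubordinatorLevyMeasure μ) {l : ℝ} (hl : 0 < l) :
    IntegrableOn (fun t : ℝ => t * Real.exp (-l * t)) (Ioi 0) μ := by
  refine Integrable.mono' (hμ.integrableOn_min.const_mul (1 + l⁻¹)) (by fun_prop) ?_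
  filter_upwards [self_mem_ae_restrict measurableSet_Ioi] with t ht
  have ht' : (0 : ℝ) < t := ht
  rw [Real.norm_of_nonneg (by positivity)]
  exact mul_exp_neg_bound hl ht'

theorem hasDerivAt_levyExponent (hμ : IsSubordinatorLevyMeasure μ) {l : ℝ} (hl : 0 < l) :
    HasDerivAt (levyExponent μ) (∫ t in Ioi (0 : ℝ), t * Real.exp (-l * t) ∂μ) l := by
  have hnhds : Ioi (l / 2) ∈ 𝓝 l := Ioi_mem_nhds (by linarith)
  refine (hasDerivAt_integral_of_dominated_loc_of_deriv_le (μ := μ.restrict (Ioi 0))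
    (F := fun l t => 1 - Real.exp (-l * t)) (F' := fun l t => t * Real.exp (-l * t))
    (bound := fun t => t * Real.exp (-(l / 2) * t)) hnhds
    (Eventually.of_forall fun _ => by fun_prop) (hμ.integrableOn_one_sub_exp hl.le) (by fun_prop)
    ?_ (hμ.integrableOn_mul_exp (by linarith)) ?_).2
  · filter_upwards [self_mem_ae_restrict measurableSet_Ioi] with t ht m hm
    have ht' : (0 : ℝ) < t := ht
    have hm' : l / 2 < m := hm
    rw [Real.norm_of_nonneg (by positivity)]
    gcongr
  · refine Eventually.of_forall fun t m _ => ?_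
    have h1 : HasDerivAt (fun m : ℝ => -m * t) (-1 * t) m := (hasDerivAt_id m).neg.mul_const t
    exact (h1.exp.const_sub 1).congr_deriv (by ring)

theorem continuousOn_levyExponent (hμ : IsSubordinatorLevyMeasure μ) :
    ContinuousOn (levyExponent μ) (Ioi 0) := fun _ hl =>
  (hμ.hasDerivAt_levyExponent hl).continuousAt.continuousWithinAt

theorem levyH_nonneg (hμ : IsSubordinatorLevyMeasure μ) {l : ℝ} (hl : 0 < l) :
    0 ≤ levyH μ l := by
  rw [levyH, (hμ.hasDerivAt_levyExponent hl).deriv, levyExponent, ← integral_const_mul, sub_nonneg]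
  refine setIntegral_mono ((hμ.integrableOn_mul_exp hl).const_mul l)
    (hμ.integrableOn_one_sub_exp hl.le) fun t => ?_
  have := mul_exp_neg_le_one_sub_exp_neg (l * t)
  simp only [neg_mul] at this ⊢
  linarith

/-- This identity is the link between `H` and `φ`: it yields both the monotonicity of `φ(l)/l` and
the transfer of scaling. -/
theorem hasDerivAt_levyExponent_div (hμ : IsSubordinatorLevyMeasure μ) {l : ℝ} (hl : 0 < l) :
    HasDerivAt (fun l => levyExponent μ l / l) (-(levyH μ l / l ^ 2)) l := by
  have h := hμ.hasDerivAt_levyExponent hl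
  refine (h.div (hasDerivAt_id l) hl.ne').congr_deriv ?_
  rw [levyH, h.deriv]
  simp only [id]
  ring

theorem levyExponent_div_antitoneOn (hμ : IsSubordinatorLevyMeasure μ) :
    AntitoneOn (fun l => levyExponent μ l / l) (Ioi 0) := by
  refine antitoneOn_of_deriv_nonpos (convex_Ioi 0)
    (fun l hl => (hμ.hasDerivAt_levyExponent_div hl).continuousAt.continuousWithinAt)
    (fun l hl => ?_) fun l hl => ?_
  · rw [interior_Ioi] at hl
    exact (hμ.hasDerivAt_levyExponent_div hl).differentiableAt.differentiableWithinAt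
  · rw [interior_Ioi] at hl
    rw [(hμ.hasDerivAt_levyExponent_div hl).deriv]
    have := hμ.levyH_nonneg hl
    have : 0 ≤ levyH μ l / l ^ 2 := by positivity
    linarith

theorem tendsto_levyExponent_zero (hμ : IsSubordinatorLevyMeasure μ) :
    Tendsto (levyExponent μ) (𝓝[>] 0) (𝓝 0) := by
  have key : Tendsto (fun l => ∫ t in Ioi (0 : ℝ), (1 - Real.exp (-l * t)) ∂μ) (𝓝[>] 0)
      (𝓝 (∫ _ in Ioi (0 : ℝ), (0 : ℝ) ∂μ)) := by
    refine tendsto_integral_filter_of_dominated_convergence (fun t => (1 + 1) * min 1 t)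
      (Eventually.of_forall fun _ => by fun_prop) ?_ (hμ.integrableOn_min.const_mul _) ?_
    · filter_upwards [Ioo_mem_nhdsGT (zero_lt_one' ℝ)] with l hl
      filter_upwards [self_mem_ae_restrict measurableSet_Ioi] with t ht
      have ht' : (0 : ℝ) < t := ht
      have h0 : 0 ≤ l * t := mul_nonneg hl.1.le ht'.le
      have h1 : Real.exp (-(l * t)) ≤ 1 := Real.exp_le_one_iff.2 (by linarith)
      rw [neg_mul, Real.norm_of_nonneg (by linarith)]
      refine (one_sub_exp_neg_le_min (l * t)).trans ((min_one_mul_le hl.1.le ht'.le).trans ?_)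
      have : 0 ≤ min 1 t := le_min zero_le_one ht'.le
      have := hl.2
      gcongr
    · refine Eventually.of_forall fun t => ?_
      have : ContinuousAt (fun l : ℝ => 1 - Real.exp (-l * t)) 0 := by fun_prop
      have h2 := this.tendsto
      simp only [neg_zero, zero_mul, Real.exp_zero, sub_self] at h2
      exact h2.mono_left nhdsWithin_le_nhds
  rw [integral_zero] at key
  exact key

/-- The absence of drift in `φ`. It removes the boundary term at infinity when scaling is
transferred from `H` to `φ`. -/
theorem tendsto_levyExponent_div_atTop (hμ : IsSubordinatorLevyMeasure μ) :
    Tendsto (fun l => levyExponent μ l / l) atTop (𝓝 0) := by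
  have key : Tendsto (fun l => ∫ t in Ioi (0 : ℝ), (1 - Real.exp (-l * t)) / l ∂μ) atTop
      (𝓝 (∫ _ in Ioi (0 : ℝ), (0 : ℝ) ∂μ)) := by
    refine tendsto_integral_filter_of_dominated_convergence (fun t => (1 + 1) * min 1 t)
      (Eventually.of_forall fun _ => by fun_prop) ?_ (hμ.integrableOn_min.const_mul _) ?_
    · filter_upwards [eventually_ge_atTop 1] with l hl
      filter_upwards [self_mem_ae_restrict measurableSet_Ioi] with t ht
      have ht' : (0 : ℝ) < t := ht
      have hl0 : 0 < l := by linarith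
      have h0 : 0 ≤ l * t := by positivity
      have h1 : Real.exp (-(l * t)) ≤ 1 := Real.exp_le_one_iff.2 (by linarith)
      have hm : 0 ≤ min 1 t := le_min zero_le_one ht'.le
      rw [neg_mul, Real.norm_of_nonneg (div_nonneg (by linarith) hl0.le), div_le_iff₀ hl0]
      refine (one_sub_exp_neg_le_min (l * t)).trans ((min_one_mul_le hl0.le ht'.le).trans ?_)
      nlinarith
    · filter_upwards [self_mem_ae_restrict measurableSet_Ioi] with t ht
      have ht' : (0 : ℝ) < t := ht
      refine squeeze_zero' ?_ ?_ tendsto_inv_atTop_zero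
      · filter_upwards [eventually_gt_atTop 0] with l hl
        have h1 : Real.exp (-l * t) ≤ 1 := Real.exp_le_one_iff.2 (by nlinarith)
        exact div_nonneg (by linarith) hl.le
      · filter_upwards [eventually_gt_atTop 0] with l hl
        rw [inv_eq_one_div]
        gcongr
        linarith [Real.exp_pos (-l * t)]
  simpa [levyExponent, integral_div] using key

/-- Monotone convergence: `φ(n + 1)` increases to the total mass of `μ` on `(0,∞)`. This makes `φ`
surjective and `T_t` almost surely positive. -/
theorem exists_lt_levyExponent (hμ : IsSubordinatorLevyMeasure μ) (hinf : μ (Ioi 0) = ∞) (M : ℝ) :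
    ∃ l, 0 < l ∧ M < levyExponent μ l := by
  by_contra! hM
  have hlim : Tendsto (fun n : ℕ => ∫⁻ t in Ioi (0 : ℝ),
      ENNReal.ofReal (1 - Real.exp (-((n : ℝ) + 1) * t)) ∂μ) atTop
      (𝓝 (∫⁻ _ in Ioi (0 : ℝ), 1 ∂μ)) := by
    refine lintegral_tendsto_of_tendsto_of_monotone (fun n => by fun_prop) ?_ ?_
    · filter_upwards [self_mem_ae_restrict measurableSet_Ioi] with t ht
      intro m n hmn
      have ht' : (0 : ℝ) < t := ht
      dsimp only
      gcongr
    · filter_upwards [self_mem_ae_restrict measurableSet_Ioi] with t ht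
      have ht' : (0 : ℝ) < t := ht
      have h1 : Tendsto (fun n : ℕ => ((n : ℝ) + 1) * t) atTop atTop :=
        (tendsto_atTop_add_const_right _ 1 tendsto_natCast_atTop_atTop).atTop_mul_const ht'
      have h2 := (Real.tendsto_exp_neg_atTop_nhds_zero.comp h1).const_sub 1
      have h3 := ENNReal.tendsto_ofReal h2
      simp only [sub_zero, ENNReal.ofReal_one] at h3
      refine h3.congr fun n => ?_
      simp only [Function.comp, neg_mul]
  rw [setLIntegral_one, hinf] at hlim
  refine absurd (le_of_tendsto' hlim (b := ENNReal.ofReal M) fun n => ?_) (by simp)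
  have hn : (0 : ℝ) < n + 1 := by positivity
  rw [← ofReal_integral_eq_lintegral_ofReal (hμ.integrableOn_one_sub_exp hn.le)]
  · exact ENNReal.ofReal_le_ofReal (hM _ hn)
  · filter_upwards [self_mem_ae_restrict measurableSet_Ioi] with t ht
    have ht' : (0 : ℝ) < t := ht
    have h1 : Real.exp (-((n : ℝ) + 1) * t) ≤ 1 := Real.exp_le_one_iff.2 (by nlinarith)
    simpa using h1

theorem surjOn_levyExponent (hμ : IsSubordinatorLevyMeasure μ) (hinf : μ (Ioi 0) = ∞) :
    SurjOn (levyExponent μ) (Ioi 0) (Ioi 0) := by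
  intro s hs
  have hs' : (0 : ℝ) < s := hs
  obtain ⟨b, hb, hsb⟩ := hμ.exists_lt_levyExponent hinf s
  obtain ⟨a, hsa, ha⟩ := ((hμ.tendsto_levyExponent_zero.eventually (gt_mem_nhds hs')).and
    (Ioo_mem_nhdsGT hb)).exists
  obtain ⟨c, hc, hcs⟩ := intermediate_value_Icc ha.2.le
    (hμ.continuousOn_levyExponent.mono fun x hx => lt_of_lt_of_le ha.1 hx.1) ⟨hsa.le, hsb.le⟩
  exact ⟨c, lt_of_lt_of_le ha.1 hc.1, hcs⟩

theorem levyExponentInv_pos (hμ : IsSubordinatorLevyMeasure μ) (hinf : μ (Ioi 0) = ∞) {s : ℝ}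
    (hs : 0 < s) : 0 < levyExponentInv μ s :=
  Function.invFunOn_mem (hμ.surjOn_levyExponent hinf hs)

theorem levyExponent_levyExponentInv (hμ : IsSubordinatorLevyMeasure μ) (hinf : μ (Ioi 0) = ∞)
    {s : ℝ} (hs : 0 < s) : levyExponent μ (levyExponentInv μ s) = s :=
  Function.invFunOn_eq (hμ.surjOn_levyExponent hinf hs)

/-- The lower scaling condition passes from `H` to `φ`, since `φ(l) / l` is the integral of
`H(s) / s ^ 2` over `(l, ∞)`. -/
theorem lowerScaling_levyExponent (hμ : IsSubordinatorLevyMeasure μ) {a γ C : ℝ}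
    (h : LowerScaling (levyH μ) a γ C) {l x : ℝ} (hl : a < l) (hx : 1 ≤ x) :
    C * x ^ γ * levyExponent μ l ≤ levyExponent μ (l * x) := by
  obtain ⟨ha, -, hC, -, hH⟩ := h
  have hx0 : 0 < x := by linarith
  have hl0 : 0 < l := by linarith
  set F : ℝ → ℝ := fun l => levyExponent μ l / l with hF
  -- Scaling of `H` makes `D` decreasing, and `D` tends to `0` at infinity, so `D ≥ 0`. This
  -- replaces the integral representation of `φ(l)/l`.
  set D : ℝ → ℝ := fun l => F (l * x) - C * x ^ γ / x * F l with hD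
  have hderiv : ∀ m, a < m → HasDerivAt D
      (-(levyH μ (m * x) / (m * x) ^ 2) * x - C * x ^ γ / x * -(levyH μ m / m ^ 2)) m := by
    intro m hm
    have hm0 : 0 < m := by linarith
    have h1 : HasDerivAt (fun m => F (m * x)) (-(levyH μ (m * x) / (m * x) ^ 2) * x) m := by
      have := (hμ.hasDerivAt_levyExponent_div (l := m * x) (by positivity)).comp m
        ((hasDerivAt_id m).mul_const x)
      exact this.congr_deriv (by ring)
    exact h1.sub ((hμ.hasDerivAt_levyExponent_div hm0).const_mul _)
  have hanti : AntitoneOn D (Ioi a) := by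
    refine antitoneOn_of_deriv_nonpos (convex_Ioi a)
      (fun m hm => (hderiv m hm).continuousAt.continuousWithinAt) (fun m hm => ?_) fun m hm => ?_
    · rw [interior_Ioi] at hm
      exact (hderiv m hm).differentiableAt.differentiableWithinAt
    · rw [interior_Ioi] at hm
      have hma : a < m := hm
      have hm0 : 0 < m := by linarith
      have h1 := hH m x hma hx
      -- Were `H(m)` zero, the quotient in the scaling condition would be `0` by convention, against
      -- its positive lower bound.
      have hne : levyH μ m ≠ 0 := by
        intro h0
        rw [h0, div_zero] at h1
        have : 0 < C * x ^ γ := by positivity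
        linarith
      have hpos : 0 < levyH μ m := lt_of_le_of_ne (hμ.levyH_nonneg hm0) (Ne.symm hne)
      rw [le_div_iff₀ hpos] at h1
      rw [(hderiv m hm).deriv]
      have h2 : -(levyH μ (m * x) / (m * x) ^ 2) * x - C * x ^ γ / x * -(levyH μ m / m ^ 2)
          = -((levyH μ (m * x) - C * x ^ γ * levyH μ m) / (m ^ 2 * x)) := by
        field_simp
        ring
      rw [h2, neg_nonpos]
      exact div_nonneg (by linarith) (by positivity)
  have hlim : Tendsto D atTop (𝓝 0) := by
    have h1 : Tendsto (fun m => F (m * x)) atTop (𝓝 0) :=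
      hμ.tendsto_levyExponent_div_atTop.comp (tendsto_id.atTop_mul_const hx0)
    simpa using h1.sub (hμ.tendsto_levyExponent_div_atTop.const_mul (C * x ^ γ / x))
  have hD0 : 0 ≤ D l := by
    refine le_of_tendsto hlim ?_
    filter_upwards [eventually_ge_atTop l] with m hm
    exact hanti hl (lt_of_lt_of_le hl hm) hm
  have h3 : D l = (levyExponent μ (l * x) - C * x ^ γ * levyExponent μ l) / (l * x) := by
    simp only [hD, hF]
    field_simp
  rw [h3] at hD0
  have := (div_nonneg_iff.1 hD0).resolve_right fun h => absurd h.2 (by simp; positivity)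
  linarith [this.1]

end IsSubordinatorLevyMeasure

/-! ### Tails and negative moments from a Laplace transform. -/

section LaplaceTransform

variable {ν : Measure ℝ} [IsProbabilityMeasure ν] {m : ℝ → ℝ}

theorem integrable_exp_neg_mul (hpos : ∀ᵐ s ∂ν, 0 ≤ s) {l : ℝ} (hl : 0 ≤ l) :
    Integrable (fun s => Real.exp (-l * s)) ν := by
  refine Integrable.of_bound (by fun_prop) 1 ?_
  filter_upwards [hpos] with s hs
  rw [Real.norm_of_nonneg (Real.exp_pos _).le]
  exact Real.exp_le_one_iff.2 (by nlinarith)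

/-- A Chebyshev bound for the upper tail in terms of the Laplace exponent. -/
theorem measureReal_Ioi_le (hpos : ∀ᵐ s ∂ν, 0 ≤ s)
    (hL : ∀ l, 0 < l → ∫ s, Real.exp (-l * s) ∂ν = Real.exp (-m l)) {r : ℝ} (hr : 0 < r) :
    ν.real (Ioi r) * (1 - Real.exp (-1)) ≤ m r⁻¹ := by
  have hr' : 0 < r⁻¹ := by positivity
  have hint := integrable_exp_neg_mul hpos hr'.le
  have h1 : ∫ s, (Ioi r).indicator (fun _ => 1 - Real.exp (-1)) s ∂ν
      ≤ ∫ s, (1 - Real.exp (-r⁻¹ * s)) ∂ν := by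
    refine integral_mono_ae ((integrable_const _).indicator measurableSet_Ioi)
      ((integrable_const _).sub hint) ?_
    filter_upwards [hpos] with s hs
    by_cases h : s ∈ Ioi r
    · have h' : r < s := h
      have h2 : 1 ≤ r⁻¹ * s := by rw [inv_mul_eq_div, le_div_iff₀ hr]; linarith
      rw [indicator_of_mem h]
      gcongr
      linarith
    · rw [indicator_of_notMem h]
      have : Real.exp (-r⁻¹ * s) ≤ 1 := Real.exp_le_one_iff.2 (by nlinarith)
      simpa using this
  rw [integral_indicator_const _ measurableSet_Ioi, integral_sub (integrable_const _) hint,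
    hL _ hr'] at h1
  simp only [integral_const, probReal_univ, smul_eq_mul, mul_one] at h1
  linarith [Real.add_one_le_exp (-m r⁻¹)]

/-- An exponential Chebyshev bound for the lower tail in terms of the Laplace exponent. -/
theorem measureReal_Iic_le (hpos : ∀ᵐ s ∂ν, 0 ≤ s)
    (hL : ∀ l, 0 < l → ∫ s, Real.exp (-l * s) ∂ν = Real.exp (-m l)) {r : ℝ} (hr : 0 < r) :
    ν.real (Iic r) ≤ Real.exp (1 - m r⁻¹) := by
  have hr' : 0 < r⁻¹ := by positivity
  have hint := integrable_exp_neg_mul hpos hr'.le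
  have h1 : ∫ s, (Iic r).indicator (fun _ => Real.exp (-1)) s ∂ν
      ≤ ∫ s, Real.exp (-r⁻¹ * s) ∂ν := by
    refine integral_mono ((integrable_const _).indicator measurableSet_Iic) hint fun s => ?_
    by_cases h : s ∈ Iic r
    · have h' : s ≤ r := h
      have h2 : r⁻¹ * s ≤ 1 := by rw [inv_mul_eq_div, div_le_one hr]; exact h'
      rw [indicator_of_mem h]
      gcongr
      linarith
    · rw [indicator_of_notMem h]
      positivity
  rw [integral_indicator_const _ measurableSet_Iic, hL _ hr', smul_eq_mul] at h1
  have h2 : ν.real (Iic r) = ν.real (Iic r) * Real.exp (-1) * Real.exp 1 := by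
    rw [mul_assoc, ← Real.exp_add]; simp
  rw [h2, sub_eq_neg_add, Real.exp_add]
  gcongr

/-- Negative moments of a positive random variable are bounded in terms of a lower bound for its
Laplace exponent. -/
theorem lintegral_rpow_neg_le (hpos : ∀ᵐ s ∂ν, 0 < s)
    (hL : ∀ l, 0 < l → ∫ s, Real.exp (-l * s) ∂ν = Real.exp (-m l)) {k C γ β : ℝ}
    (hk : 0 < k) (hC : 0 < C) (hγ : 0 < γ) (hβ : 0 < β)
    (hm : ∀ l, 0 < l → C * (l / β) ^ γ - C ≤ m l) :
    ∫⁻ s, ENNReal.ofReal (s ^ (-k)) ∂ν ≤ ENNReal.ofReal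
      (Real.exp C * C ^ (-k / γ) * γ⁻¹ * Real.Gamma (k / γ) / Real.Gamma k * β ^ k) := by
  have hG : 0 < Real.Gamma k := Real.Gamma_pos_of_pos hk
  -- The Gamma integral writes `Γ(k) s^(-k)` as a superposition of `e^(-ls)`, so that Tonelli brings
  -- in the Laplace transform.
  have hinner : ∀ s : ℝ, 0 < s → ENNReal.ofReal (s ^ (-k)) * ENNReal.ofReal (Real.Gamma k) =
      ∫⁻ l in Ioi (0 : ℝ), ENNReal.ofReal (l ^ (k - 1) * Real.exp (-l * s)) := by
    intro s hs
    rw [← ENNReal.ofReal_mul (by positivity), ← ofReal_integral_eq_lintegral_ofReal]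
    · congr 1
      have := Real.integral_rpow_mul_exp_neg_mul_Ioi hk hs
      simp only [neg_mul, mul_comm s] at this ⊢
      rw [this, one_div, Real.inv_rpow hs.le, Real.rpow_neg hs.le]
    · have := integrableOn_rpow_mul_exp_neg_mul_rpow (p := 1) (s := k - 1) (by linarith)
        one_pos hs
      refine this.congr_fun (fun l _ => ?_) measurableSet_Ioi
      simp [mul_comm]
    · filter_upwards [self_mem_ae_restrict measurableSet_Ioi] with l hl
      have : (0 : ℝ) < l := hl
      simp only [Pi.zero_apply]
      positivity
  have hb : 0 < C * β ^ (-γ) := by positivity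
  have houter : ∀ l ∈ Ioi (0 : ℝ), ∫⁻ s, ENNReal.ofReal (l ^ (k - 1) * Real.exp (-l * s)) ∂ν ≤
      ENNReal.ofReal (Real.exp C * (l ^ (k - 1) * Real.exp (-(C * β ^ (-γ)) * l ^ γ))) := by
    intro l hl
    have hl' : (0 : ℝ) < l := hl
    rw [← ofReal_integral_eq_lintegral_ofReal
      ((integrable_exp_neg_mul (hpos.mono fun _ h => h.le) hl'.le).const_mul _)
      (Eventually.of_forall fun s => by simp only [Pi.zero_apply]; positivity),
      integral_const_mul, hL l hl']
    refine ENNReal.ofReal_le_ofReal ?_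
    rw [mul_left_comm, ← Real.exp_add]
    gcongr
    have h1 := hm l hl'
    rw [Real.div_rpow hl'.le hβ.le, div_eq_mul_inv, ← Real.rpow_neg hβ.le] at h1
    nlinarith
  have hint := integrableOn_rpow_mul_exp_neg_mul_rpow (p := γ) (s := k - 1) (b := C * β ^ (-γ))
    (by linarith) hγ hb
  have hmain : (∫⁻ s, ENNReal.ofReal (s ^ (-k)) ∂ν) * ENNReal.ofReal (Real.Gamma k) ≤
      ENNReal.ofReal (Real.exp C * C ^ (-k / γ) * γ⁻¹ * Real.Gamma (k / γ) * β ^ k) := by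
    calc (∫⁻ s, ENNReal.ofReal (s ^ (-k)) ∂ν) * ENNReal.ofReal (Real.Gamma k)
        = ∫⁻ s, ENNReal.ofReal (s ^ (-k)) * ENNReal.ofReal (Real.Gamma k) ∂ν :=
          (lintegral_mul_const' _ _ ENNReal.ofReal_ne_top).symm
      _ = ∫⁻ s, (∫⁻ l in Ioi (0 : ℝ), ENNReal.ofReal (l ^ (k - 1) * Real.exp (-l * s))) ∂ν :=
          lintegral_congr_ae (hpos.mono hinner)
      _ = ∫⁻ l in Ioi (0 : ℝ), ∫⁻ s, ENNReal.ofReal (l ^ (k - 1) * Real.exp (-l * s)) ∂ν :=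
          lintegral_lintegral_swap (by fun_prop)
      _ ≤ ∫⁻ l in Ioi (0 : ℝ),
          ENNReal.ofReal (Real.exp C * (l ^ (k - 1) * Real.exp (-(C * β ^ (-γ)) * l ^ γ))) :=
          setLIntegral_mono' measurableSet_Ioi houter
      _ = ENNReal.ofReal (Real.exp C * C ^ (-k / γ) * γ⁻¹ * Real.Gamma (k / γ) * β ^ k) := by
          rw [← ofReal_integral_eq_lintegral_ofReal (hint.const_mul _),
            integral_const_mul, integral_rpow_mul_exp_neg_mul_rpow hγ (by linarith) hb]
          · congr 1
            rw [Real.mul_rpow hC.le (by positivity), ← Real.rpow_mul hβ.le]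
            have h1 : -γ * (-(k - 1 + 1) / γ) = k := by field_simp; ring
            have h2 : -(k - 1 + 1) / γ = -k / γ := by ring
            rw [h1, h2, sub_add_cancel]
            ring
          · filter_upwards [self_mem_ae_restrict measurableSet_Ioi] with l hl
            have : (0 : ℝ) < l := hl
            simp only [Pi.zero_apply]
            positivity
  rw [← ENNReal.le_div_iff_mul_le (by simp [hG]) (by simp), ← ENNReal.ofReal_div_of_pos hG] at hmain
  convert hmain using 2
  ring

end LaplaceTransform

/-! ### Uniqueness of Laplace transforms. -/

/-- The exponential series may be integrated term by term because `|Y| ≤ 1`. Hence the moments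
determine the law of a variable with values in `[0,1]`. -/
theorem hasSum_integral_exp_mul_of_mem_Icc {Ω : Type*} [MeasurableSpace Ω] {P : Measure Ω}
    [IsProbabilityMeasure P] {Y : Ω → ℝ} (hY : AEMeasurable Y P) (h01 : ∀ᵐ ω ∂P, Y ω ∈ Icc (0 : ℝ) 1)
    (z : ℂ) :
    HasSum (fun n : ℕ => z ^ n / (n.factorial : ℂ) * ((∫ ω, Y ω ^ n ∂P : ℝ) : ℂ))
      (complexMGF Y P z) := by
  have hmeas : ∀ n : ℕ, AEStronglyMeasurable (fun ω => z ^ n / (n.factorial : ℂ) * (Y ω : ℂ) ^ n) P :=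
    fun n => (by fun_prop : AEMeasurable _ P).aestronglyMeasurable
  have hbd : ∀ n : ℕ, ∀ᵐ ω ∂P, ‖z ^ n / (n.factorial : ℂ) * (Y ω : ℂ) ^ n‖ ≤
      ‖z‖ ^ n / n.factorial := by
    intro n
    filter_upwards [h01] with ω hω
    rw [norm_mul, norm_div, norm_pow, norm_pow, Complex.norm_natCast, Complex.norm_real,
      Real.norm_of_nonneg hω.1]
    exact mul_le_of_le_one_right (by positivity) (pow_le_one₀ hω.1 hω.2)
  have key := hasSum_integral_of_summable_integral_norm (μ := P)
    (F := fun (n : ℕ) ω => z ^ n / (n.factorial : ℂ) * (Y ω : ℂ) ^ n)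
    (fun n => Integrable.of_bound (hmeas n) _ (hbd n)) ?_
  · have e₁ : (fun n : ℕ => z ^ n / (n.factorial : ℂ) * ((∫ ω, Y ω ^ n ∂P : ℝ) : ℂ)) =
        fun n : ℕ => ∫ ω, z ^ n / (n.factorial : ℂ) * (Y ω : ℂ) ^ n ∂P := by
      funext n
      rw [integral_const_mul, ← integral_complex_ofReal]
      simp
    have e₂ : complexMGF Y P z = ∫ ω, ∑' n : ℕ, z ^ n / (n.factorial : ℂ) * (Y ω : ℂ) ^ n ∂P := by
      refine integral_congr_ae (Eventually.of_forall fun ω => ?_)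
      have h := NormedSpace.expSeries_div_hasSum_exp (𝔸 := ℂ) (z * (Y ω : ℂ))
      rw [← Complex.exp_eq_exp_ℂ] at h
      refine h.tsum_eq.symm.trans ?_
      refine tsum_congr fun n => ?_
      rw [mul_pow]; ring
    rw [e₁, e₂]
    exact key
  · refine Summable.of_nonneg_of_le (fun n => integral_nonneg fun _ => norm_nonneg _) (fun n => ?_)
      (Real.summable_pow_div_factorial ‖z‖)
    refine (integral_mono_ae (Integrable.of_bound (hmeas n) _ (hbd n)).norm
      (integrable_const _) (hbd n)).trans ?_
    simp

/-- A probability measure on `[0, ∞)` is determined by its Laplace transform. -/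
theorem measure_eq_of_laplace_eq {ν₁ ν₂ : Measure ℝ} [IsProbabilityMeasure ν₁]
    [IsProbabilityMeasure ν₂] (h₁ : ∀ᵐ s ∂ν₁, 0 ≤ s) (h₂ : ∀ᵐ s ∂ν₂, 0 ≤ s)
    (h : ∀ l : ℝ, 0 < l → ∫ s, Real.exp (-l * s) ∂ν₁ = ∫ s, Real.exp (-l * s) ∂ν₂) : ν₁ = ν₂ := by
  -- Under `s ↦ e^(-s)` the measures move to `[0,1]`, and their `n`-th moments are the Laplace
  -- transforms at `n`. The logarithm moves them back.
  have hE : Measurable fun s : ℝ => Real.exp (-s) := by fun_prop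
  have hI : ∀ {ν : Measure ℝ}, (∀ᵐ s ∂ν, 0 ≤ s) → ∀ᵐ s ∂ν, Real.exp (-s) ∈ Icc (0 : ℝ) 1 :=
    fun h => h.mono fun s hs => ⟨(Real.exp_pos _).le, Real.exp_le_one_iff.2 (by linarith)⟩
  have hmap : ν₁.map (fun s => Real.exp (-s)) = ν₂.map (fun s => Real.exp (-s)) := by
    refine Measure.ext_of_complexMGF_eq hE.aemeasurable hE.aemeasurable (funext fun z => ?_)
    have hmom : ∀ n : ℕ, ∫ s, Real.exp (-s) ^ n ∂ν₁ = ∫ s, Real.exp (-s) ^ n ∂ν₂ := by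
      intro n
      rcases Nat.eq_zero_or_pos n with rfl | hn
      · simp
      · have := h n (by exact_mod_cast hn)
        simpa only [← Real.exp_nat_mul, mul_neg, neg_mul] using this
    have key := hasSum_integral_exp_mul_of_mem_Icc hE.aemeasurable (hI h₁) z
    simp only [hmom] at key
    exact key.unique (hasSum_integral_exp_mul_of_mem_Icc hE.aemeasurable (hI h₂) z)
  have hlog : Measurable fun y : ℝ => -Real.log y := by fun_prop
  have := congrArg (Measure.map fun y : ℝ => -Real.log y) hmap
  rw [Measure.map_map hlog hE, Measure.map_map hlog hE] at this
  simpa [Function.comp_def, Measure.map_id'] using this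

/-! ### Comparison of Gaussian kernels at different times. -/

section GaussKernel

variable {d : ℕ}

theorem gaussKernel_nonneg {t : ℝ} (ht : 0 ≤ t) (x : Euc d) : 0 ≤ gaussKernel t x := by
  unfold gaussKernel
  positivity

theorem measurable_gaussKernel : Measurable fun z : ℝ × Euc d => gaussKernel z.1 z.2 := by
  unfold gaussKernel
  fun_prop

theorem measurable_gaussKernel_left (x : Euc d) : Measurable fun s : ℝ => gaussKernel s x :=
  measurable_gaussKernel.comp measurable_prodMk_right

theorem measurable_gaussKernel_right (s : ℝ) : Measurable fun x : Euc d => gaussKernel s x :=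
  measurable_gaussKernel.comp measurable_prodMk_left

theorem gaussKernel_zero_right (t : ℝ) :
    gaussKernel t (0 : Euc d) = (4 * Real.pi * t) ^ (-(d : ℝ) / 2) := by
  simp [gaussKernel]

theorem gaussKernel_le_rpow {t s : ℝ} (ht : 0 < t) (hts : t ≤ s) (x : Euc d) :
    gaussKernel s x ≤ (4 * Real.pi * t) ^ (-(d : ℝ) / 2) := by
  have hs : 0 < s := ht.trans_le hts
  have h1 : Real.exp (-‖x‖ ^ 2 / (4 * s)) ≤ 1 :=
    Real.exp_le_one_iff.2 (div_nonpos_of_nonpos_of_nonneg (by simp) (by positivity))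
  refine (mul_le_of_le_one_right (by positivity) h1).trans ?_
  refine Real.rpow_le_rpow_of_nonpos (by positivity) (by gcongr) ?_
  have : (0 : ℝ) ≤ d := by positivity
  linarith

theorem rpow_neg_four_pi_mul_le {t : ℝ} (ht : 0 < t) :
    (4 * Real.pi * t) ^ (-(d : ℝ) / 2) ≤ t ^ (-(d : ℝ) / 2) := by
  refine Real.rpow_le_rpow_of_nonpos ht ?_ ?_
  · nlinarith [Real.pi_gt_three]
  · have : (0 : ℝ) ≤ d := by positivity
    linarith

theorem rpow_neg_mul_rpow_div {s s' : ℝ} (hs : 0 < s) (hs' : 0 < s') :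
    (4 * Real.pi * s) ^ (-(d : ℝ) / 2) =
      (s' / s) ^ ((d : ℝ) / 2) * (4 * Real.pi * s') ^ (-(d : ℝ) / 2) := by
  rw [neg_div, Real.rpow_neg (by positivity), Real.rpow_neg (by positivity),
    ← Real.inv_rpow (by positivity), ← Real.inv_rpow (by positivity),
    ← Real.mul_rpow (by positivity) (by positivity)]
  congr 1
  field_simp

/-- The exponential factor increases in time, so only the ratio of the prefactors is lost. -/
theorem gaussKernel_le_mul {s s' : ℝ} (hs : 0 < s) (hss' : s ≤ s') (x : Euc d) :
    gaussKernel s x ≤ (s' / s) ^ ((d : ℝ) / 2) * gaussKernel s' x := by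
  have hs' : 0 < s' := hs.trans_le hss'
  unfold gaussKernel
  rw [rpow_neg_mul_rpow_div hs hs', mul_assoc]
  refine mul_le_mul_of_nonneg_left ?_ (by positivity)
  refine mul_le_mul_of_nonneg_left ?_ (by positivity)
  refine Real.exp_le_exp.2 ?_
  rw [neg_div, neg_div, neg_le_neg_iff]
  gcongr

/-- In time the Gaussian kernel at `x` is increasing up to `‖x‖ ^ 2 / (2 * d)`. -/
theorem gaussKernel_mono {s s' : ℝ} (hs : 0 < s) (hss' : s ≤ s') {x : Euc d}
    (hx : 2 * d * s' ≤ ‖x‖ ^ 2) : gaussKernel s x ≤ gaussKernel s' x := by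
  have hs' : 0 < s' := hs.trans_le hss'
  unfold gaussKernel
  rw [rpow_neg_mul_rpow_div hs hs', mul_comm ((s' / s) ^ _), mul_assoc]
  refine mul_le_mul_of_nonneg_left ?_ (by positivity)
  have hdiv : 0 < s' / s := by positivity
  rw [Real.rpow_def_of_pos hdiv, ← Real.exp_add]
  refine Real.exp_le_exp.2 ?_
  -- The bound `log u ≤ u - 1` turns the comparison of prefactor and exponential into a rational
  -- inequality.
  have h1 : Real.log (s' / s) * ((d : ℝ) / 2) ≤ (s' / s - 1) * ((d : ℝ) / 2) := by
    gcongr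
    exact Real.log_le_sub_one_of_pos hdiv
  have h2 : (s' / s - 1) * ((d : ℝ) / 2) = 2 * d * s' * ((s' - s) / (4 * s * s')) := by
    field_simp
    ring
  have h3 : 2 * d * s' * ((s' - s) / (4 * s * s')) ≤ ‖x‖ ^ 2 * ((s' - s) / (4 * s * s')) := by
    have : 0 ≤ (s' - s) / (4 * s * s') := div_nonneg (by linarith) (by positivity)
    gcongr
  have h4 : ‖x‖ ^ 2 * ((s' - s) / (4 * s * s')) = ‖x‖ ^ 2 / (4 * s) - ‖x‖ ^ 2 / (4 * s') := by
    field_simp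
  rw [neg_div, neg_div]
  linarith

/-- Doubling the time is absorbed by dividing `x` by `√2`; this is the source of the spatial
constants in the upper bounds. -/
theorem gaussKernel_le_smul {r r' : ℝ} (hr : 0 < r) (hrr' : r ≤ r') (hr' : r' ≤ 2 * r)
    (x : Euc d) : gaussKernel r' x ≤ gaussKernel r ((√2)⁻¹ • x) := by
  have hr'0 : 0 < r' := hr.trans_le hrr'
  have hd : (0 : ℝ) ≤ d := by positivity
  have hn : ‖(√2)⁻¹ • x‖ ^ 2 = ‖x‖ ^ 2 / 2 := by
    rw [norm_smul, mul_pow, Real.norm_of_nonneg (by positivity), inv_pow, Real.sq_sqrt (by simp)]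
    ring
  unfold gaussKernel
  rw [hn]
  refine mul_le_mul ?_ ?_ (Real.exp_pos _).le (by positivity)
  · exact Real.rpow_le_rpow_of_nonpos (by positivity) (by gcongr) (by linarith)
  · refine Real.exp_le_exp.2 ?_
    rw [neg_div, neg_div, neg_le_neg_iff, div_div]
    exact div_le_div_of_nonneg_left (by positivity) (by positivity) (by linarith)

/-- The kernel is largest at time `|x|²/(2d)`. The resulting bound makes the integral defining `q`
converge away from the origin. -/
theorem gaussKernel_le_of_ne_zero (hd : 1 ≤ d) {x : Euc d} (hx : x ≠ 0) {s : ℝ} (hs : 0 < s) :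
    gaussKernel s x ≤ (4 * Real.pi * (‖x‖ ^ 2 / (2 * d))) ^ (-(d : ℝ) / 2) := by
  have hd' : (0 : ℝ) < d := by exact_mod_cast hd
  have hx' : 0 < ‖x‖ := norm_pos_iff.2 hx
  have h0 : 0 < ‖x‖ ^ 2 / (2 * d) := by positivity
  rcases le_total s (‖x‖ ^ 2 / (2 * d)) with h | h
  · refine (gaussKernel_mono hs h ?_).trans (gaussKernel_le_rpow h0 le_rfl x)
    exact (mul_div_cancel₀ _ (by positivity)).le
  · exact gaussKernel_le_rpow h0 h x

end GaussKernel

/-! ### Gaussian mixtures with and without the time shift. -/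

section Mixture

variable {d : ℕ} {ν : Measure ℝ}

theorem integral_gaussKernel_nonneg (hpos : ∀ᵐ s ∂ν, 0 < s) (x : Euc d) :
    0 ≤ ∫ s, gaussKernel s x ∂ν :=
  integral_nonneg_of_ae (hpos.mono fun _ hs => gaussKernel_nonneg (le_of_lt hs) x)

theorem integral_gaussKernel_add_nonneg (hpos : ∀ᵐ s ∂ν, 0 < s) {t : ℝ} (ht : 0 < t) (x : Euc d) :
    0 ≤ ∫ s, gaussKernel (t + s) x ∂ν :=
  integral_nonneg_of_ae (hpos.mono fun _ hs => gaussKernel_nonneg (add_pos ht hs).le x)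

variable [IsProbabilityMeasure ν]

theorem integrable_gaussKernel_add (hpos : ∀ᵐ s ∂ν, 0 < s) {t : ℝ} (ht : 0 < t) (x : Euc d) :
    Integrable (fun s => gaussKernel (t + s) x) ν := by
  refine Integrable.of_bound ?_ ((4 * Real.pi * t) ^ (-(d : ℝ) / 2)) ?_
  · exact ((measurable_gaussKernel_left x).comp (by fun_prop)).aestronglyMeasurable
  · filter_upwards [hpos] with s hs
    rw [Real.norm_of_nonneg (gaussKernel_nonneg (by positivity) x)]
    exact gaussKernel_le_rpow ht (by linarith) x

theorem integrable_gaussKernel (hpos : ∀ᵐ s ∂ν, 0 < s) (hd : 1 ≤ d) {x : Euc d} (hx : x ≠ 0) :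
    Integrable (fun s => gaussKernel s x) ν := by
  refine Integrable.of_bound (measurable_gaussKernel_left x).aestronglyMeasurable
    ((4 * Real.pi * (‖x‖ ^ 2 / (2 * d))) ^ (-(d : ℝ) / 2)) ?_
  filter_upwards [hpos] with s hs
  rw [Real.norm_of_nonneg (gaussKernel_nonneg hs.le x)]
  exact gaussKernel_le_of_ne_zero hd hx hs

theorem integral_gaussKernel_add_le_rpow (hpos : ∀ᵐ s ∂ν, 0 < s) {t : ℝ} (ht : 0 < t)
    (x : Euc d) : ∫ s, gaussKernel (t + s) x ∂ν ≤ (4 * Real.pi * t) ^ (-(d : ℝ) / 2) := by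
  refine (integral_mono_ae (integrable_gaussKernel_add hpos ht x) (integrable_const _)
    (hpos.mono fun s hs => gaussKernel_le_rpow ht ?_ x)).trans (by simp)
  linarith

theorem integral_gaussKernel_add_le (hpos : ∀ᵐ s ∂ν, 0 < s) (hd : 1 ≤ d) {t : ℝ} (ht : 0 < t)
    (x : Euc d) : ∫ s, gaussKernel (t + s) x ∂ν ≤
      gaussKernel t ((√2)⁻¹ • x) + ∫ s, gaussKernel s ((√2)⁻¹ • x) ∂ν := by
  -- At the origin the unshifted kernel need not be integrable in `s`; the kernel at time `t` alone
  -- suffices there.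
  rcases eq_or_ne x 0 with rfl | hx
  · refine (integral_gaussKernel_add_le_rpow hpos ht _).trans ?_
    rw [smul_zero, gaussKernel_zero_right]
    linarith [integral_gaussKernel_nonneg (d := d) hpos 0]
  · have hx' : (√2)⁻¹ • x ≠ 0 := smul_ne_zero (by positivity) hx
    have hint := integrable_gaussKernel hpos hd hx'
    have h1 := integral_mono_ae (integrable_gaussKernel_add hpos ht x)
      ((integrable_const (gaussKernel t ((√2)⁻¹ • x))).add hint) (hpos.mono fun s hs => ?_)
    · refine h1.trans (le_of_eq ?_)
      simp only [Pi.add_apply]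
      rw [integral_add (integrable_const _) hint]
      simp
    · have ht' := gaussKernel_nonneg ht.le ((√2)⁻¹ • x)
      have hs' := gaussKernel_nonneg (le_of_lt hs) ((√2)⁻¹ • x)
      have hs0 : 0 < s := hs
      simp only [Pi.add_apply]
      rcases le_total s t with h | h
      · linarith [gaussKernel_le_smul ht (r' := t + s) (by linarith) (by linarith) x]
      · linarith [gaussKernel_le_smul hs (r' := t + s) (by linarith) (by linarith) x]

/-- If the mixing law puts mass at least `1 / 4` on a window `[α, β]`, and `t + α`, `t + β` are
comparable, then the mixture of the kernels at times `t + s` dominates both the kernel at time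
`t` and the mixture of the kernels at times `s`, after truncation at `(t + α) ^ (-d / 2)`. -/
theorem min_le_mul_integral_gaussKernel_add (hpos : ∀ᵐ s ∂ν, 0 < s) {t α β K : ℝ} (ht : 0 < t)
    (hα : 0 ≤ α) (hβ : t + β ≤ K * (t + α)) (hν : 1 / 4 ≤ ν.real (Icc α β)) (x : Euc d) :
    min ((t + α) ^ (-(d : ℝ) / 2)) (gaussKernel t x + ∫ s, gaussKernel s x ∂ν) ≤
      (4 * K ^ ((d : ℝ) / 2) * ((4 * Real.pi) ^ ((d : ℝ) / 2) * Real.exp (d / 2) + 2)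
        + 2 ^ ((d : ℝ) / 2)) * ∫ s, gaussKernel (t + s) x ∂ν := by
  set r := t + α with hr
  have hr0 : 0 < r := by positivity
  set p := ∫ s, gaussKernel (t + s) x ∂ν with hp
  have hp0 : 0 ≤ p := integral_gaussKernel_add_nonneg hpos ht x
  have hint := integrable_gaussKernel_add hpos ht x
  have hαβ : α ≤ β := by
    by_contra h
    rw [Icc_eq_empty h] at hν
    norm_num at hν
  have hK0 : 0 < K := by
    have : 0 < t + β := by linarith
    exact pos_of_mul_pos_left (this.trans_le hβ) hr0.le
  -- On the window `t + s` is between `r` and `K r`; the factor `4` pays for its mass.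
  have hgr : gaussKernel r x ≤ 4 * K ^ ((d : ℝ) / 2) * p := by
    have h1 : ∫ s, (Icc α β).indicator (fun _ => gaussKernel r x) s ∂ν ≤
        ∫ s, K ^ ((d : ℝ) / 2) * gaussKernel (t + s) x ∂ν := by
      refine integral_mono_ae ((integrable_const _).indicator measurableSet_Icc)
        (hint.const_mul _) (hpos.mono fun s hs => ?_)
      have hs' : 0 < t + s := add_pos ht hs
      have hg := gaussKernel_nonneg hs'.le x
      by_cases h : s ∈ Icc α β
      · rw [indicator_of_mem h]
        refine (gaussKernel_le_mul hr0 (by linarith [h.1] : r ≤ t + s) x).trans ?_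
        have : (t + s) / r ≤ K := by
          rw [div_le_iff₀ hr0]
          linarith [h.2]
        dsimp only
        gcongr
      · rw [indicator_of_notMem h]
        positivity
    rw [integral_indicator_const _ measurableSet_Icc, integral_const_mul, smul_eq_mul] at h1
    have h2 : 1 / 4 * gaussKernel r x ≤ ν.real (Icc α β) * gaussKernel r x :=
      mul_le_mul_of_nonneg_right hν (gaussKernel_nonneg hr0.le x)
    linarith
  have hKp : 0 ≤ 4 * K ^ ((d : ℝ) / 2) * p := by positivity
  have h2p : 0 ≤ 2 ^ ((d : ℝ) / 2) * p := by positivity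
  have hE : 0 ≤ (4 * Real.pi) ^ ((d : ℝ) / 2) * Real.exp (d / 2) := by positivity
  -- Near the origin the exponential factor at time `r` is at least `e^(-d/2)`; farther out the
  -- kernel increases in time up to `r`.
  rcases le_total (‖x‖ ^ 2) (2 * d * r) with hx | hx
  · refine (min_le_left _ _).trans ?_
    have h1 : r ^ (-(d : ℝ) / 2) ≤
        (4 * Real.pi) ^ ((d : ℝ) / 2) * Real.exp (d / 2) * gaussKernel r x := by
      unfold gaussKernel
      have h3 : r ^ (-(d : ℝ) / 2) = (4 * Real.pi) ^ ((d : ℝ) / 2) *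
          (4 * Real.pi * r) ^ (-(d : ℝ) / 2) := by
        rw [Real.mul_rpow (by positivity) hr0.le, ← mul_assoc, ← Real.rpow_add (by positivity)]
        rw [show (d : ℝ) / 2 + -d / 2 = 0 by ring, Real.rpow_zero, one_mul]
      have h4 : 1 ≤ Real.exp (d / 2) * Real.exp (-‖x‖ ^ 2 / (4 * r)) := by
        rw [← Real.exp_add, Real.one_le_exp_iff, neg_div]
        have : ‖x‖ ^ 2 / (4 * r) ≤ d / 2 := by
          rw [div_le_iff₀ (by positivity)]
          linarith
        linarith
      rw [h3]
      calc _ ≤ (4 * Real.pi) ^ ((d : ℝ) / 2) * (4 * Real.pi * r) ^ (-(d : ℝ) / 2) *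
          (Real.exp (d / 2) * Real.exp (-‖x‖ ^ 2 / (4 * r))) :=
            le_mul_of_one_le_right (by positivity) h4
        _ = _ := by ring
    nlinarith [mul_le_mul_of_nonneg_left hgr hE]
  · refine (min_le_right _ _).trans ?_
    have h1 : gaussKernel t x ≤ gaussKernel r x := gaussKernel_mono ht (by linarith) hx
    have h2 : ∫ s, gaussKernel s x ∂ν ≤
        ∫ s, (gaussKernel r x + 2 ^ ((d : ℝ) / 2) * gaussKernel (t + s) x) ∂ν := by
      refine integral_mono_of_nonneg
        (hpos.mono fun s hs => gaussKernel_nonneg (le_of_lt hs) x)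
        ((integrable_const _).add (hint.const_mul _)) (hpos.mono fun s hs => ?_)
      have hs0 : 0 < s := hs
      have hg := gaussKernel_nonneg (add_pos ht hs).le x
      have hgr0 := gaussKernel_nonneg hr0.le x
      rcases le_total s r with h | h
      · have h5 := gaussKernel_mono hs h hx
        have : 0 ≤ 2 ^ ((d : ℝ) / 2) * gaussKernel (t + s) x := by positivity
        dsimp only
        linarith
      -- Here `t ≤ r ≤ s`, so adding `t` at most doubles the time.
      · have h5 := gaussKernel_le_mul hs (by linarith : s ≤ t + s) x
        have h6 : (t + s) / s ≤ 2 := by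
          rw [div_le_iff₀ hs]
          linarith
        have h7 : ((t + s) / s) ^ ((d : ℝ) / 2) * gaussKernel (t + s) x ≤
            2 ^ ((d : ℝ) / 2) * gaussKernel (t + s) x := by
          gcongr
        dsimp only
        linarith
    rw [integral_add (integrable_const _) (hint.const_mul _), integral_const_mul] at h2
    simp only [integral_const, probReal_univ, smul_eq_mul, one_mul] at h2
    nlinarith [mul_nonneg hE hKp]

end Mixture

/-! ### Positivity and typical size of the subordinator. -/

theorem ae_pos_of_laplace {ν : Measure ℝ} [IsProbabilityMeasure ν] {m : ℝ → ℝ}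
    (hpos : ∀ᵐ s ∂ν, 0 ≤ s)
    (hL : ∀ l, 0 < l → ∫ s, Real.exp (-l * s) ∂ν = Real.exp (-m l))
    (hm : ∀ M, ∃ l, 0 < l ∧ M < m l) : ∀ᵐ s ∂ν, 0 < s := by
  have h0 : ν.real (Iic 0) = 0 := by
    refine le_antisymm (le_of_forall_pos_le_add fun ε hε => ?_) measureReal_nonneg
    obtain ⟨l, hl, hml⟩ := hm (1 - Real.log ε)
    have h1 : ν.real (Iic 0) ≤ ν.real (Iic l⁻¹) :=
      measureReal_mono (Iic_subset_Iic.2 (by positivity))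
    have h2 := measureReal_Iic_le hpos hL (r := l⁻¹) (by positivity)
    rw [inv_inv] at h2
    have h3 : Real.exp (1 - m l) ≤ ε := by
      rw [← Real.exp_log hε]
      exact Real.exp_le_exp.2 (by linarith)
    linarith
  rw [measureReal_eq_zero_iff] at h0
  rw [ae_iff]
  convert h0 using 2
  ext s
  simp

/-- Since `1 - e^(-1) ≥ 1/2`, the upper tail is at most `1/2`; with at most `1/4` below, `1/4`
remains. -/
theorem quarter_le_measureReal_Icc {ν : Measure ℝ} [IsProbabilityMeasure ν] {α β : ℝ}
    (hα : ν.real (Iio α) ≤ 1 / 4) (hβ : ν.real (Ioi β) * (1 - Real.exp (-1)) ≤ 1 / 4) :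
    1 / 4 ≤ ν.real (Icc α β) := by
  have he : Real.exp (-1) ≤ 1 / 2 := by
    rw [Real.exp_neg, one_div]
    gcongr
    linarith [Real.add_one_le_exp 1]
  have hβ0 : 0 ≤ ν.real (Ioi β) := measureReal_nonneg
  have hcover : ν.real univ ≤ ν.real (Iio α) + ν.real (Icc α β) + ν.real (Ioi β) := by
    refine (measureReal_mono (?_ : univ ⊆ Iio α ∪ Icc α β ∪ Ioi β)).trans
      ((measureReal_union_le _ _).trans (by gcongr; exact measureReal_union_le _ _))
    intro s _
    rcases lt_or_ge s α with h | h
    · exact Or.inl (Or.inl h)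
    · rcases le_or_gt s β with h' | h'
      · exact Or.inl (Or.inr ⟨h, h'⟩)
      · exact Or.inr h'
  rw [probReal_univ] at hcover
  nlinarith

namespace IsSubordinatorLevyMeasure

variable {μ : Measure ℝ}

/-- On a bounded time interval a driftless subordinator is at most of linear size with
probability at least `1 / 4`. -/
theorem exists_quarter_le_measureReal_Icc (hμ : IsSubordinatorLevyMeasure μ) {T₀ : ℝ}
    (hT₀ : 0 < T₀) : ∃ K : ℝ, ∀ (ν : Measure ℝ) [IsProbabilityMeasure ν] (t : ℝ), 0 < t → t ≤ T₀ →
      (∀ᵐ s ∂ν, 0 < s) →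
      (∀ l, 0 < l → ∫ s, Real.exp (-l * s) ∂ν = Real.exp (-(t * levyExponent μ l))) →
      1 / 4 ≤ ν.real (Icc 0 (K * t)) := by
  -- Choose `l` with `T₀ φ(l) < 1/4`. The window ends at `β = t/(l T₀)`, and since `φ(l)/l`
  -- decreases, `t φ(1/β) ≤ T₀ φ(l)`.
  obtain ⟨l, hφ, hl⟩ := ((hμ.tendsto_levyExponent_zero.eventually
    (gt_mem_nhds (show (0 : ℝ) < 1 / (4 * T₀) by positivity))).and self_mem_nhdsWithin).exists
  have hl0 : 0 < l := hl
  refine ⟨1 / (l * T₀), fun ν _ t ht htT hpos hL => quarter_le_measureReal_Icc ?_ ?_⟩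
  · have : ν.real (Iio 0) = 0 := by
      rw [measureReal_eq_zero_iff]
      refine measure_mono_null (fun s hs => ?_) (ae_iff.1 hpos)
      exact not_lt.2 (le_of_lt hs)
    linarith
  · refine (measureReal_Ioi_le (hpos.mono fun _ h => h.le) hL (by positivity)).trans ?_
    have hinv : (1 / (l * T₀) * t)⁻¹ = l * (T₀ / t) := by field_simp
    have hge : l ≤ l * (T₀ / t) := le_mul_of_one_le_right hl0.le ((one_le_div ht).2 htT)
    have h1 := hμ.levyExponent_div_antitoneOn hl0 (hl0.trans_le hge) hge
    dsimp only at h1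
    rw [hinv]
    rw [div_le_div_iff₀ (hl0.trans_le hge) hl0] at h1
    rw [lt_div_iff₀ (by positivity)] at hφ
    have h2 : levyExponent μ (l * (T₀ / t)) * t ≤ levyExponent μ l * T₀ := by
      have : levyExponent μ l * (l * (T₀ / t)) = levyExponent μ l * T₀ / t * l := by ring
      rw [this] at h1
      have := le_of_mul_le_mul_right h1 hl0
      rwa [le_div_iff₀ ht] at this
    linarith

variable {γ C : ℝ}

theorem mul_rpow_le_mul_levyExponent (hμ : IsSubordinatorLevyMeasure μ) (hinf : μ (Ioi 0) = ∞)
    (h : LowerScaling (levyH μ) 0 γ C) {t x : ℝ} (ht : 0 < t) (hx : 1 ≤ x) :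
    C * x ^ γ ≤ t * levyExponent μ (levyExponentInv μ t⁻¹ * x) := by
  have ht' : 0 < t⁻¹ := by positivity
  have h1 := hμ.lowerScaling_levyExponent h (hμ.levyExponentInv_pos hinf ht') hx
  rw [hμ.levyExponent_levyExponentInv hinf ht', ← div_eq_mul_inv, div_le_iff₀ ht] at h1
  linarith

/-- Under global lower scaling a driftless subordinator at time `t` is comparable to
`1 / φ⁻¹(1 / t)` with probability at least `1 / 4`. -/
theorem quarter_le_measureReal_Icc_inv (hμ : IsSubordinatorLevyMeasure μ)
    (hinf : μ (Ioi 0) = ∞) (h : LowerScaling (levyH μ) 0 γ C) {ν : Measure ℝ}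
    [IsProbabilityMeasure ν] {t : ℝ} (ht : 0 < t) (hpos : ∀ᵐ s ∂ν, 0 < s)
    (hL : ∀ l, 0 < l → ∫ s, Real.exp (-l * s) ∂ν = Real.exp (-(t * levyExponent μ l))) :
    1 / 4 ≤ ν.real (Icc ((4 / C) ^ γ⁻¹ * levyExponentInv μ t⁻¹)⁻¹
      ((4 / C) ^ γ⁻¹ / levyExponentInv μ t⁻¹)) := by
  obtain ⟨-, hγ, hC, hC1, -⟩ := id h
  have ht' : 0 < t⁻¹ := by positivity
  set B := levyExponentInv μ t⁻¹ with hB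
  have hB0 : 0 < B := hμ.levyExponentInv_pos hinf ht'
  -- Chosen so that `C K^γ = 4`: then `t φ(BK) ≥ 4` bounds the lower tail by `e^(-3)`, and `t φ(B/K)
  -- ≤ 1/4` controls the upper one.
  set K := (4 / C) ^ γ⁻¹ with hK
  have h4C : 1 ≤ 4 / C := by rw [le_div_iff₀ hC]; linarith
  have hK1 : 1 ≤ K := Real.one_le_rpow h4C (by positivity)
  have hK0 : 0 < K := by linarith
  have hKγ : C * K ^ γ = 4 := by
    rw [hK, ← Real.rpow_mul (by positivity), inv_mul_cancel₀ hγ.ne', Real.rpow_one]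
    field_simp
  have hpos' : ∀ᵐ s ∂ν, 0 ≤ s := hpos.mono fun _ h => h.le
  refine quarter_le_measureReal_Icc ?_ ?_
  · refine (measureReal_mono Iio_subset_Iic_self).trans
      ((measureReal_Iic_le hpos' hL (by positivity)).trans ?_)
    rw [inv_inv, mul_comm K]
    have h1 := hμ.mul_rpow_le_mul_levyExponent hinf h ht hK1
    rw [hKγ] at h1
    calc Real.exp (1 - t * levyExponent μ (B * K)) ≤ Real.exp (-3) :=
          Real.exp_le_exp.2 (by linarith)
      _ ≤ 1 / 4 := by
          rw [Real.exp_neg, one_div]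
          gcongr
          linarith [Real.add_one_le_exp 3]
  · refine (measureReal_Ioi_le hpos' hL (by positivity)).trans ?_
    rw [inv_div]
    have h1 := hμ.lowerScaling_levyExponent h (l := B / K) (by positivity) hK1
    rw [hKγ, div_mul_cancel₀ _ hK0.ne', hμ.levyExponent_levyExponentInv hinf ht',
      inv_eq_one_div, le_div_iff₀ ht] at h1
    linarith

/-- Dropping `t` from `t + s` leaves the moment `E T_t^(-d/2)`. The moment bound at scale `β =
φ⁻¹(1/t)` has a constant free of `t`. -/
theorem exists_integral_gaussKernel_add_le (hμ : IsSubordinatorLevyMeasure μ)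
    (hinf : μ (Ioi 0) = ∞) (h : LowerScaling (levyH μ) 0 γ C) {d : ℕ} (hd : 1 ≤ d) :
    ∃ A : ℝ, ∀ (ν : Measure ℝ) [IsProbabilityMeasure ν] (t : ℝ), 0 < t → (∀ᵐ s ∂ν, 0 < s) →
      (∀ l, 0 < l → ∫ s, Real.exp (-l * s) ∂ν = Real.exp (-(t * levyExponent μ l))) →
      ∀ x : Euc d, ∫ s, gaussKernel (t + s) x ∂ν ≤ A * levyExponentInv μ t⁻¹ ^ ((d : ℝ) / 2) := by
  obtain ⟨-, hγ, hC, -, -⟩ := id h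
  have hd' : (0 : ℝ) < (d : ℝ) / 2 := by
    have : (1 : ℝ) ≤ d := by exact_mod_cast hd
    linarith
  refine ⟨Real.exp C * C ^ (-((d : ℝ) / 2) / γ) * γ⁻¹ * Real.Gamma ((d : ℝ) / 2 / γ) /
    Real.Gamma ((d : ℝ) / 2), fun ν _ t ht hpos hL x => ?_⟩
  have hB0 : 0 < levyExponentInv μ t⁻¹ := hμ.levyExponentInv_pos hinf (by positivity)
  have hbd := lintegral_rpow_neg_le hpos hL hd' hC hγ hB0 fun l hl => ?_
  · rw [integral_eq_lintegral_of_nonneg_ae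
      (hpos.mono fun s hs => gaussKernel_nonneg (add_pos ht hs).le x)
      (integrable_gaussKernel_add hpos ht x).aestronglyMeasurable]
    refine ENNReal.toReal_le_of_le_ofReal ?_ ((lintegral_mono_ae (hpos.mono fun s hs => ?_)).trans
      hbd)
    · have := Real.Gamma_pos_of_pos hd'
      have := Real.Gamma_pos_of_pos (div_pos hd' hγ)
      positivity
    · refine ENNReal.ofReal_le_ofReal ?_
      rw [← neg_div]
      exact (gaussKernel_le_rpow hs (by linarith) x).trans (rpow_neg_four_pi_mul_le hs)
  · have hB := hμ.levyExponentInv_pos hinf (inv_pos.2 ht)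
    rcases le_total (levyExponentInv μ t⁻¹) l with hle | hle
    · have h1 := hμ.mul_rpow_le_mul_levyExponent hinf h ht ((one_le_div hB).2 hle)
      rw [mul_div_cancel₀ _ hB.ne'] at h1
      linarith
    -- Below the scale `β` scaling says nothing, but subtracting `C` makes the required bound
    -- nonpositive.
    · have h1 : (l / levyExponentInv μ t⁻¹) ^ γ ≤ 1 :=
        Real.rpow_le_one (by positivity) ((div_le_one hB).2 hle) hγ.le
      have h2 : 0 ≤ t * levyExponent μ l := mul_nonneg ht.le (levyExponent_nonneg μ hl.le)
      nlinarith

end IsSubordinatorLevyMeasure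

/-! ### Brownian motion at an independent random time. -/

section RandomTime

variable {d : ℕ} {Ω : Type*} [MeasurableSpace Ω] {P : Measure Ω} {W : ℝ≥0 → Ω → Euc d}

theorem IsBrownianMotion.hasLaw (hW : IsBrownianMotion W P) {t : ℝ≥0} (ht : 0 < t) :
    HasLaw (W t) (volume.withDensity fun x => ENNReal.ofReal (gaussKernel t x)) P := by
  have h := hW.law_increments 0 t ht
  simp only [NNReal.coe_zero, sub_zero] at h
  refine h.congr ?_
  filter_upwards [hW.zero] with ω hω
  rw [hω, sub_zero]

/-- Rounding up to a grid of mesh `1/(n+1)` makes random times countably valued; path continuity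
then recovers `W_τ`. -/
theorem tendsto_ceil_mul_div_nnreal (s : ℝ≥0) :
    Tendsto (fun n : ℕ => (⌈((n : ℝ≥0) + 1) * s⌉₊ : ℝ≥0) / ((n : ℝ≥0) + 1)) atTop (𝓝 s) := by
  have h1 : Tendsto (fun n : ℕ => (n : ℝ) + 1) atTop atTop :=
    tendsto_atTop_add_const_right _ 1 tendsto_natCast_atTop_atTop
  have h2 := (tendsto_nat_ceil_mul_div_atTop (R := ℝ) s.coe_nonneg).comp h1
  rw [← NNReal.tendsto_coe]
  refine h2.congr fun n => ?_
  simp only [Function.comp, NNReal.coe_div, NNReal.coe_natCast, NNReal.coe_add, NNReal.coe_one]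
  congr 2
  refine eq_of_forall_ge_iff fun m => ?_
  rw [Nat.ceil_le, Nat.ceil_le, mul_comm, ← NNReal.coe_le_coe]
  simp

theorem measurable_comp_countable {β : Type*} [MeasurableSpace β] {Z : ℕ → Ω → β}
    (hZ : ∀ k, Measurable (Z k)) {κ : Ω → ℕ} (hκ : Measurable κ) :
    Measurable fun ω => Z (κ ω) ω := by
  have h1 : Measurable fun z : Ω × ℕ => Z z.2 z.1 := measurable_from_prod_countable_left hZ
  exact h1.comp (measurable_id.prodMk hκ)

theorem IsBrownianMotion.ae_tendsto_ceil (hW : IsBrownianMotion W P) (τ : Ω → ℝ≥0) :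
    ∀ᵐ ω ∂P, Tendsto (fun n : ℕ => W ((⌈((n : ℝ≥0) + 1) * τ ω⌉₊ : ℝ≥0) / ((n : ℝ≥0) + 1)) ω) atTop
      (𝓝 (W (τ ω) ω)) := by
  filter_upwards [hW.continuous_paths] with ω hω
  exact (hω.tendsto _).comp (tendsto_ceil_mul_div_nnreal (τ ω))

theorem IsBrownianMotion.measurable_ceil (hW : IsBrownianMotion W P) {τ : Ω → ℝ≥0}
    (hτ : Measurable τ) (n : ℕ) :
    Measurable fun ω => W ((⌈((n : ℝ≥0) + 1) * τ ω⌉₊ : ℝ≥0) / ((n : ℝ≥0) + 1)) ω := by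
  have hκ : Measurable fun ω => ⌈((n : ℝ≥0) + 1) * τ ω⌉₊ :=
    Nat.measurable_ceil.comp (hτ.const_mul _)
  exact measurable_comp_countable (Z := fun k => W ((k : ℝ≥0) / ((n : ℝ≥0) + 1)))
    (fun k => hW.measurable _) hκ

theorem IsBrownianMotion.aemeasurable_comp (hW : IsBrownianMotion W P) {τ : Ω → ℝ≥0}
    (hτ : Measurable τ) : AEMeasurable (fun ω => W (τ ω) ω) P :=
  aemeasurable_of_tendsto_metrizable_ae atTop (fun n => (hW.measurable_ceil hτ n).aemeasurable)
    (hW.ae_tendsto_ceil τ)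

variable [IsProbabilityMeasure P]

/-- Independence and Fubini. With a countable index set, evaluation of a path at an index is jointly
measurable. -/
theorem lintegral_comp_countable_time {Z : ℕ → Ω → Euc d} (hZ : ∀ k, Measurable (Z k))
    {κ : Ω → ℕ} (hκ : Measurable κ) (hind : IndepFun (fun ω k => Z k ω) κ P) {f : Euc d → ℝ≥0∞}
    (hf : Measurable f) :
    ∫⁻ ω, f (Z (κ ω) ω) ∂P = ∫⁻ ω, ∫⁻ ω', f (Z (κ ω) ω') ∂P ∂P := by
  have hZm : Measurable fun ω k => Z k ω := measurable_pi_iff.2 hZ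
  have hF : Measurable fun z : (ℕ → Euc d) × ℕ => f (z.1 z.2) :=
    measurable_from_prod_countable_left fun k => hf.comp (measurable_pi_apply k)
  calc ∫⁻ ω, f (Z (κ ω) ω) ∂P
      = ∫⁻ z : (ℕ → Euc d) × ℕ, f (z.1 z.2) ∂(P.map fun ω => (fun k => Z k ω, κ ω)) :=
        (lintegral_map hF (hZm.prodMk hκ)).symm
    _ = ∫⁻ k, ∫⁻ z : ℕ → Euc d, f (z k) ∂(P.map fun ω k => Z k ω) ∂(P.map κ) := by
        rw [(indepFun_iff_map_prod_eq_prod_map_map hZm.aemeasurable hκ.aemeasurable).1 hind]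
        have : IsProbabilityMeasure (P.map κ) := Measure.isProbabilityMeasure_map hκ.aemeasurable
        have : IsProbabilityMeasure (P.map fun ω k => Z k ω) :=
          Measure.isProbabilityMeasure_map hZm.aemeasurable
        exact lintegral_prod_symm' _ hF
    _ = ∫⁻ ω, ∫⁻ ω', f (Z (κ ω) ω') ∂P ∂P := by
        rw [lintegral_map measurable_from_top hκ]
        refine lintegral_congr fun ω => ?_
        exact lintegral_map (hf.comp (measurable_pi_apply _)) hZm

theorem tendsto_lintegral_comp {X : Ω → Euc d} {Xn : ℕ → Ω → Euc d} (hXn : ∀ n, Measurable (Xn n))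
    (h : ∀ᵐ ω ∂P, Tendsto (fun n => Xn n ω) atTop (𝓝 (X ω)))
    (f : BoundedContinuousFunction (Euc d) ℝ≥0) :
    Tendsto (fun n => ∫⁻ ω, f (Xn n ω) ∂P) atTop (𝓝 (∫⁻ ω, f (X ω) ∂P)) := by
  have hf : Continuous fun x => (f x : ℝ≥0∞) := ENNReal.continuous_coe.comp f.continuous
  refine tendsto_lintegral_of_dominated_convergence (fun _ => (nndist 0 f : ℝ≥0∞))
    (fun n => hf.measurable.comp (hXn n)) (fun n => Eventually.of_forall fun ω => ?_) (by simp) ?_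
  · exact ENNReal.coe_le_coe.2 (f.apply_le_nndist_zero (Xn n ω))
  · filter_upwards [h] with ω hω
    exact (hf.tendsto _).comp hω

/-- Paths are continuous only almost surely, so evaluation on the product σ-algebra cannot be used
directly; the identity on the grid passes to the limit on both sides for bounded continuous `f`. -/
theorem IsBrownianMotion.lintegral_comp (hW : IsBrownianMotion W P) {τ : Ω → ℝ≥0}
    (hτ : Measurable τ) (hind : IndepFun (fun ω t => W t ω) τ P)
    (f : BoundedContinuousFunction (Euc d) ℝ≥0) :
    ∫⁻ ω, f (W (τ ω) ω) ∂P = ∫⁻ ω, ∫⁻ ω', f (W (τ ω) ω') ∂P ∂P := by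
  have hf : Measurable fun x => (f x : ℝ≥0∞) :=
    (ENNReal.continuous_coe.comp f.continuous).measurable
  have h1 := tendsto_lintegral_comp (hW.measurable_ceil hτ) (hW.ae_tendsto_ceil τ) f
  have h2 : Tendsto (fun n : ℕ => ∫⁻ ω, ∫⁻ ω',
      f (W ((⌈((n : ℝ≥0) + 1) * τ ω⌉₊ : ℝ≥0) / ((n : ℝ≥0) + 1)) ω') ∂P ∂P) atTop
      (𝓝 (∫⁻ ω, ∫⁻ ω', f (W (τ ω) ω') ∂P ∂P)) := by
    refine tendsto_lintegral_of_dominated_convergence (fun _ => (nndist 0 f : ℝ≥0∞))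
      (fun n => ?_) (fun n => Eventually.of_forall fun ω => ?_) (by simp)
      (Eventually.of_forall fun ω => ?_)
    · have : Measurable fun k : ℕ => ∫⁻ ω', f (W ((k : ℝ≥0) / ((n : ℝ≥0) + 1)) ω') ∂P :=
        measurable_from_top
      exact this.comp (Nat.measurable_ceil.comp (hτ.const_mul _))
    · refine (lintegral_mono fun ω' => ?_).trans_eq (by simp : ∫⁻ _, (nndist 0 f : ℝ≥0∞) ∂P = _)
      exact ENNReal.coe_le_coe.2 (f.apply_le_nndist_zero _)
    · exact tendsto_lintegral_comp (fun n => hW.measurable _) (hW.ae_tendsto_ceil fun _ => τ ω) f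
  refine tendsto_nhds_unique h1 (h2.congr fun n => ?_)
  refine (lintegral_comp_countable_time (Z := fun k => W ((k : ℝ≥0) / ((n : ℝ≥0) + 1)))
    (fun k => hW.measurable _) (Nat.measurable_ceil.comp (hτ.const_mul _)) ?_ hf).symm
  exact hind.comp (φ := fun w (k : ℕ) => w ((k : ℝ≥0) / ((n : ℝ≥0) + 1)))
    (measurable_pi_iff.2 fun k => measurable_pi_apply _)
    (Nat.measurable_ceil.comp (measurable_id.const_mul _))

/-- The law of a Brownian motion at an independent positive random time is a mixture of
Gaussian laws. -/
theorem IsBrownianMotion.hasLaw_comp (hd : 1 ≤ d) (hW : IsBrownianMotion W P) {τ : Ω → ℝ≥0}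
    (hτ : Measurable τ) (hτ0 : ∀ᵐ ω ∂P, 0 < τ ω) (hind : IndepFun (fun ω t => W t ω) τ P) :
    HasLaw (fun ω => W (τ ω) ω) (volume.withDensity fun x => ENNReal.ofReal
      (∫ s, gaussKernel s x ∂(P.map fun ω => (τ ω : ℝ)))) P := by
  have hX := hW.aemeasurable_comp hτ
  refine ⟨hX, ?_⟩
  have hτ' : Measurable fun ω => (τ ω : ℝ) := measurable_coe_nnreal_real.comp hτ
  set ν := P.map fun ω => (τ ω : ℝ) with hν
  have : IsProbabilityMeasure ν := Measure.isProbabilityMeasure_map hτ'.aemeasurable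
  have : IsProbabilityMeasure (P.map fun ω => W (τ ω) ω) := Measure.isProbabilityMeasure_map hX
  have hpos : ∀ᵐ s ∂ν, 0 < s := by
    rw [hν, ae_map_iff hτ'.aemeasurable measurableSet_Ioi]
    exact hτ0
  have hg : Measurable fun z : ℝ × Euc d => ENNReal.ofReal (gaussKernel z.1 z.2) :=
    measurable_gaussKernel.ennreal_ofReal
  -- The real integral and the `ℝ≥0∞` integral may differ at the origin, where the latter can be
  -- infinite; that point is null because `d ≥ 1`.
  have hdens : (fun x : Euc d => ENNReal.ofReal (∫ s, gaussKernel s x ∂ν)) =ᵐ[volume]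
      fun x => ∫⁻ s, ENNReal.ofReal (gaussKernel s x) ∂ν := by
    have : Nonempty (Fin d) := ⟨⟨0, hd⟩⟩
    have hne : ∀ᵐ x : Euc d, x ≠ 0 := by
      rw [ae_iff]
      simp
    filter_upwards [hne] with x hx
    exact ofReal_integral_eq_lintegral_ofReal (integrable_gaussKernel hpos hd hx)
      (hpos.mono fun s hs => gaussKernel_nonneg (le_of_lt hs) x)
  rw [withDensity_congr_ae hdens]
  refine ext_of_forall_lintegral_eq_of_IsFiniteMeasure fun f => ?_
  have hf : Measurable fun x => (f x : ℝ≥0∞) :=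
    (ENNReal.continuous_coe.comp f.continuous).measurable
  rw [lintegral_map' hf.aemeasurable hX, hW.lintegral_comp hτ hind f,
    lintegral_withDensity_eq_lintegral_mul _ hg.lintegral_prod_left' hf]
  calc ∫⁻ ω, ∫⁻ ω', f (W (τ ω) ω') ∂P ∂P
      = ∫⁻ ω, (∫⁻ x, ENNReal.ofReal (gaussKernel (τ ω : ℝ) x) * f x) ∂P := by
        refine lintegral_congr_ae ?_
        filter_upwards [hτ0] with ω hω
        have hlaw := hW.hasLaw hω
        rw [← lintegral_map' hf.aemeasurable hlaw.aemeasurable, hlaw.map_eq,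
          lintegral_withDensity_eq_lintegral_mul _
            (measurable_gaussKernel_right _).ennreal_ofReal hf]
        rfl
    _ = ∫⁻ s, (∫⁻ x, ENNReal.ofReal (gaussKernel s x) * f x) ∂ν := by
        rw [hν, lintegral_map _ hτ']
        exact (hg.mul (hf.comp measurable_snd)).lintegral_prod_right'
    _ = ∫⁻ x, ∫⁻ s, ENNReal.ofReal (gaussKernel s x) * f x ∂ν :=
        lintegral_lintegral_swap (hg.mul (hf.comp measurable_snd)).aemeasurable
    _ = _ := by
        refine lintegral_congr fun x => ?_
        rw [Pi.mul_apply, lintegral_mul_const _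
          (measurable_gaussKernel_left x).ennreal_ofReal]

end RandomTime

/-! ### Laws of subordinators and the transition densities. -/

section SubordinatorLaw

variable {Ω : Type*} [MeasurableSpace Ω] {P : Measure Ω} {S : ℝ≥0 → Ω → ℝ≥0} {ψ : ℝ → ℝ}

theorem IsSubordinator.measurable_coe (hS : IsSubordinator S P) (t : ℝ≥0) :
    Measurable fun ω => (S t ω : ℝ) :=
  measurable_coe_nnreal_real.comp (hS.measurable t)

theorem IsSubordinator.ae_law_nonneg (hS : IsSubordinator S P) (t : ℝ≥0) :
    ∀ᵐ s ∂(P.map fun ω => (S t ω : ℝ)), 0 ≤ s := by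
  rw [ae_map_iff (hS.measurable_coe t).aemeasurable measurableSet_Ici]
  exact Eventually.of_forall fun ω => (S t ω).coe_nonneg

theorem HasLaplaceExponent.integral_law (hψ : HasLaplaceExponent S P ψ) (hS : IsSubordinator S P)
    (t : ℝ≥0) {l : ℝ} (hl : 0 < l) :
    ∫ s, Real.exp (-l * s) ∂(P.map fun ω => (S t ω : ℝ)) = Real.exp (-(t * ψ l)) := by
  rw [integral_map (hS.measurable_coe t).aemeasurable (by fun_prop), hψ t l hl, neg_mul]

theorem subordinateDensity_eq_integral {d : ℕ} {t : ℝ≥0}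
    (hpos : ∀ᵐ s ∂(P.map fun ω => (S t ω : ℝ)), 0 < s) (x : Euc d) :
    subordinateDensity d S P t x = ∫ s, gaussKernel s x ∂(P.map fun ω => (S t ω : ℝ)) := by
  rw [subordinateDensity, Measure.restrict_eq_self_of_ae_mem (s := Ioi 0) hpos]

variable [IsProbabilityMeasure P]

theorem IsSubordinator.isProbabilityMeasure_law (hS : IsSubordinator S P) (t : ℝ≥0) :
    IsProbabilityMeasure (P.map fun ω => (S t ω : ℝ)) :=
  Measure.isProbabilityMeasure_map (hS.measurable_coe t).aemeasurable

theorem HasLaplaceExponent.ae_law_pos (hψ : HasLaplaceExponent S P ψ) (hS : IsSubordinator S P)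
    (hunb : ∀ M, ∃ l, 0 < l ∧ M < ψ l) {t : ℝ≥0} (ht : 0 < t) :
    ∀ᵐ s ∂(P.map fun ω => (S t ω : ℝ)), 0 < s := by
  have := hS.isProbabilityMeasure_law t
  refine ae_pos_of_laplace (hS.ae_law_nonneg t) (fun l hl => hψ.integral_law hS t hl) fun M => ?_
  obtain ⟨l, hl, hM⟩ := hunb (M / t)
  have ht' : (0 : ℝ) < t := ht
  exact ⟨l, hl, by rwa [div_lt_iff₀' ht'] at hM⟩

theorem isTransitionDensity_subordinate {d : ℕ} (hd : 1 ≤ d) {W : ℝ≥0 → Ω → Euc d}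
    (hW : IsBrownianMotion W P) (hS : IsSubordinator S P) (hψ : HasLaplaceExponent S P ψ)
    (hunb : ∀ M, ∃ l, 0 < l ∧ M < ψ l) (hind : IndepFun (fun ω t => W t ω) (fun ω t => S t ω) P) :
    IsTransitionDensity (subordinate W S) P (subordinateDensity d S P) := by
  intro t ht
  have hpos := hψ.ae_law_pos hS hunb ht
  simp only [subordinateDensity_eq_integral hpos]
  refine ⟨integral_gaussKernel_nonneg hpos, hW.hasLaw_comp hd (hS.measurable t) ?_ ?_⟩
  · exact ae_of_ae_map (hS.measurable_coe t).aemeasurable hpos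
  · exact hind.comp (φ := id) (ψ := fun w : ℝ≥0 → ℝ≥0 => w t) measurable_id (measurable_pi_apply t)

/-- Adding a unit drift to the Laplace exponent shifts the law at time `t` by `t`. -/
theorem subordinateDensity_eq_integral_add {d : ℕ} {φ : ℝ → ℝ}
    (hS : IsSubordinator S P) (hSψ : HasLaplaceExponent S P fun l => l + φ l)
    {Ω' : Type*} [MeasurableSpace Ω'] {P' : Measure Ω'} [IsProbabilityMeasure P']
    {T : ℝ≥0 → Ω' → ℝ≥0} (hT : IsSubordinator T P') (hTφ : HasLaplaceExponent T P' φ)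
    {t : ℝ≥0} (hpos : ∀ᵐ s ∂(P'.map fun ω => (T t ω : ℝ)), 0 < s) (ht : 0 < t) (x : Euc d) :
    subordinateDensity d S P t x =
      ∫ s, gaussKernel (t + s) x ∂(P'.map fun ω => (T t ω : ℝ)) := by
  have := hS.isProbabilityMeasure_law t
  have := hT.isProbabilityMeasure_law t
  have hadd : Measurable fun s : ℝ => (t : ℝ) + s := by fun_prop
  have := Measure.isProbabilityMeasure_map (μ := P'.map fun ω => (T t ω : ℝ)) hadd.aemeasurable
  have ht' : (0 : ℝ) < t := ht
  have hpos' : ∀ᵐ s ∂((P'.map fun ω => (T t ω : ℝ)).map fun s => (t : ℝ) + s), 0 < s := by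
    rw [ae_map_iff hadd.aemeasurable measurableSet_Ioi]
    exact hpos.mono fun s hs => add_pos ht' hs
  have hlaw : (P.map fun ω => (S t ω : ℝ)) =
      (P'.map fun ω => (T t ω : ℝ)).map fun s => (t : ℝ) + s := by
    refine measure_eq_of_laplace_eq (hS.ae_law_nonneg t) (hpos'.mono fun _ h => h.le)
      fun l hl => ?_
    rw [hSψ.integral_law hS t hl, integral_map hadd.aemeasurable (by fun_prop)]
    simp only [mul_add, Real.exp_add]
    rw [integral_const_mul, hTφ.integral_law hT t hl, ← Real.exp_add]
    congr 1
    ring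
  rw [subordinateDensity_eq_integral (hlaw ▸ hpos'), hlaw,
    integral_map hadd.aemeasurable (measurable_gaussKernel_left x).aestronglyMeasurable]

end SubordinatorLaw

/-! ### Assembly of the two-sided estimates. -/

/-- The left side is `max(t, 1/B)^(-k)`, and `t + ρ` is at most twice that maximum. -/
theorem min_rpow_le_mul_rpow_add {t B ρ k : ℝ} (ht : 0 < t) (hB : 0 < B) (hρ : 0 < ρ)
    (hρB : ρ ≤ B⁻¹) (hk : 0 ≤ k) :
    min (t ^ (-k)) (B ^ k) ≤ 2 ^ k * (t + ρ) ^ (-k) := by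
  have hmul : ∀ m : ℝ, 0 < m → t + ρ ≤ 2 * m → m ^ (-k) ≤ 2 ^ k * (t + ρ) ^ (-k) := by
    intro m hm h
    have h1 : (2 * m) ^ (-k) ≤ (t + ρ) ^ (-k) :=
      Real.rpow_le_rpow_of_nonpos (by positivity) h (by linarith)
    have h2 : m ^ (-k) = 2 ^ k * (2 * m) ^ (-k) := by
      rw [Real.mul_rpow (by norm_num) hm.le, ← mul_assoc, ← Real.rpow_add (by norm_num)]
      simp
    rw [h2]
    gcongr
  rcases le_total t B⁻¹ with h | h
  · refine (min_le_right _ _).trans ?_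
    have := hmul B⁻¹ (by positivity) (by linarith)
    rwa [Real.inv_rpow hB.le, ← Real.rpow_neg hB.le, neg_neg] at this
  · exact (min_le_left _ _).trans (hmul t ht (by linarith))

theorem theorem1p2 {d : ℕ} (hd : 1 ≤ d)
    (μ : Measure ℝ) (hμ : IsSubordinatorLevyMeasure μ) (hμ_inf : μ (Set.Ioi 0) = ∞)
    {Ω : Type*} [MeasurableSpace Ω] (P : Measure Ω) [IsProbabilityMeasure P]
    (W : ℝ≥0 → Ω → Euc d) (S : ℝ≥0 → Ω → ℝ≥0)
    (hW : IsBrownianMotion W P) (hS : IsSubordinator S P)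
    (hSψ : HasLaplaceExponent S P (fun l => l + levyExponent μ l))
    (hWS : IndepFun (fun ω t => W t ω) (fun ω t => S t ω) P)
    {Ω' : Type*} [MeasurableSpace Ω'] (P' : Measure Ω') [IsProbabilityMeasure P']
    (W' : ℝ≥0 → Ω' → Euc d) (T : ℝ≥0 → Ω' → ℝ≥0)
    (hW' : IsBrownianMotion W' P') (hT : IsSubordinator T P')
    (hTφ : HasLaplaceExponent T P' (levyExponent μ))
    (hWT : IndepFun (fun ω t => W' t ω) (fun ω t => T t ω) P')
    (p q : ℝ≥0 → Euc d → ℝ)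
    (hp : p = subordinateDensity d S P) (hq : q = subordinateDensity d T P') :
    (IsTransitionDensity (subordinate W S) P p ∧ IsTransitionDensity (subordinate W' T) P' q) ∧
    (∀ a γ C_L δ C_U : ℝ, 0 < a →
      LowerScaling (levyH μ) a γ C_L → UpperScaling (levyH μ) a δ C_U → δ < 2 →
      ∀ T₀ M : ℝ, 0 < T₀ → 0 < M →
        ∃ c₁ c₂ c₃ c₄ c₅ : ℝ, 0 < c₁ ∧ 0 < c₂ ∧ 0 < c₃ ∧ 0 < c₄ ∧ 0 < c₅ ∧
          ∀ (t : ℝ≥0) (x : Euc d), 0 < t → (t : ℝ) ≤ T₀ → ‖x‖ ≤ M / 2 →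
            c₁⁻¹ * min ((t : ℝ) ^ (-(d : ℝ) / 2))
                (gaussKernel t (c₂ • x) + q t (c₃ • x)) ≤ p t x ∧
            p t x ≤ c₁ * min ((t : ℝ) ^ (-(d : ℝ) / 2))
                (gaussKernel t (c₄ • x) + q t (c₅ • x))) ∧
    (∀ γ C_L δ C_U : ℝ,
      LowerScaling (levyH μ) 0 γ C_L → UpperScaling (levyH μ) 0 δ C_U → δ < 2 →
      ∃ c₆ c₇ c₈ c₉ c₁₀ : ℝ, 0 < c₆ ∧ 0 < c₇ ∧ 0 < c₈ ∧ 0 < c₉ ∧ 0 < c₁₀ ∧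
        ∀ (t : ℝ≥0) (x : Euc d), 0 < t →
          c₆⁻¹ * min (min ((t : ℝ) ^ (-(d : ℝ) / 2))
                (levyExponentInv μ ((t : ℝ)⁻¹) ^ ((d : ℝ) / 2)))
              (gaussKernel t (c₇ • x) + q t (c₈ • x)) ≤ p t x ∧
          p t x ≤ c₆ * min (min ((t : ℝ) ^ (-(d : ℝ) / 2))
                (levyExponentInv μ ((t : ℝ)⁻¹) ^ ((d : ℝ) / 2)))
              (gaussKernel t (c₉ • x) + q t (c₁₀ • x))) := by
  have hunbT := hμ.exists_lt_levyExponent hμ_inf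
  have hunbS : ∀ M, ∃ l, 0 < l ∧ M < l + levyExponent μ l := fun M => by
    obtain ⟨l, hl, hM⟩ := hunbT M
    exact ⟨l, hl, by linarith⟩
  have hposT : ∀ t : ℝ≥0, 0 < t → ∀ᵐ s ∂(P'.map fun ω => (T t ω : ℝ)), 0 < s :=
    fun t ht => hTφ.ae_law_pos hT hunbT ht
  have hprob := hT.isProbabilityMeasure_law
  have hlap := fun (t : ℝ≥0) (l : ℝ) (hl : 0 < l) => hTφ.integral_law hT t hl
  have hpt : ∀ t : ℝ≥0, 0 < t → ∀ x : Euc d,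
      p t x = ∫ s, gaussKernel (t + s) x ∂(P'.map fun ω => (T t ω : ℝ)) := fun t ht x => by
    rw [hp]
    exact subordinateDensity_eq_integral_add hS hSψ hT hTφ (hposT t ht) ht x
  have hqt : ∀ t : ℝ≥0, 0 < t → ∀ x : Euc d,
      q t x = ∫ s, gaussKernel s x ∂(P'.map fun ω => (T t ω : ℝ)) := fun t ht x => by
    rw [hq]
    exact subordinateDensity_eq_integral (hposT t ht) x
  have hp0 : ∀ t : ℝ≥0, 0 < t → ∀ x : Euc d, 0 ≤ p t x := fun t ht x => by
    rw [hpt t ht]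
    exact integral_gaussKernel_add_nonneg (hposT t ht) (NNReal.coe_pos.2 ht) x
  have hup1 : ∀ t : ℝ≥0, 0 < t → ∀ x : Euc d, p t x ≤ (t : ℝ) ^ (-(d : ℝ) / 2) :=
    fun t ht x => by
      rw [hpt t ht]
      exact (integral_gaussKernel_add_le_rpow (hposT t ht) (NNReal.coe_pos.2 ht) x).trans
        (rpow_neg_four_pi_mul_le (NNReal.coe_pos.2 ht))
  have hup2 : ∀ t : ℝ≥0, 0 < t → ∀ x : Euc d,
      p t x ≤ gaussKernel t ((√2)⁻¹ • x) + q t ((√2)⁻¹ • x) := fun t ht x => by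
    rw [hpt t ht, hqt t ht]
    exact integral_gaussKernel_add_le (hposT t ht) hd (NNReal.coe_pos.2 ht) x
  have hsqrt : 0 < (√2)⁻¹ := by positivity
  refine ⟨⟨hp ▸ isTransitionDensity_subordinate hd hW hS hSψ hunbS hWS,
    hq ▸ isTransitionDensity_subordinate hd hW' hT hTφ hunbT hWT⟩, ?_, ?_⟩
  · intro a γ C_L δ C_U _ _ _ _ T₀ M hT₀ _
    obtain ⟨K, hK⟩ := hμ.exists_quarter_le_measureReal_Icc hT₀
    set A : ℝ := 4 * (1 + K) ^ ((d : ℝ) / 2) * ((4 * Real.pi) ^ ((d : ℝ) / 2) *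
      Real.exp (d / 2) + 2) + 2 ^ ((d : ℝ) / 2) with hA
    have hc : 0 < max A 1 := by positivity
    refine ⟨max A 1, 1, 1, (√2)⁻¹, (√2)⁻¹, hc, one_pos, one_pos, hsqrt, hsqrt,
      fun t x ht htT _ => ⟨?_, ?_⟩⟩
    · have ht' : (0 : ℝ) < t := ht
      have hlow := min_le_mul_integral_gaussKernel_add (K := 1 + K) (hposT t ht) ht' le_rfl
        (by linarith) (hK _ t ht' htT (hposT t ht) (hlap t)) x
      rw [add_zero, ← hA, ← hpt t ht, ← hqt t ht] at hlow
      rw [one_smul, inv_mul_le_iff₀ hc]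
      exact hlow.trans (mul_le_mul_of_nonneg_right (le_max_left _ _) (hp0 t ht x))
    · have h1 := le_min (hup1 t ht x) (hup2 t ht x)
      exact h1.trans (le_mul_of_one_le_left ((hp0 t ht x).trans h1) (le_max_right _ _))
  · intro γ C_L δ C_U hlow _ _
    obtain ⟨A₁, hA₁⟩ := hμ.exists_integral_gaussKernel_add_le hμ_inf hlow hd
    obtain ⟨-, hγ, hC, hC1, -⟩ := id hlow
    set K : ℝ := (4 / C_L) ^ γ⁻¹ with hKdef
    have hK1 : 1 ≤ K := Real.one_le_rpow (by rw [le_div_iff₀ hC]; linarith) (by positivity)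
    set A : ℝ := 4 * (K ^ 2) ^ ((d : ℝ) / 2) * ((4 * Real.pi) ^ ((d : ℝ) / 2) *
      Real.exp (d / 2) + 2) + 2 ^ ((d : ℝ) / 2) with hA
    have hA0 : 0 ≤ A := by positivity
    -- `A₁` serves the bound by `φ⁻¹(1/t)^(d/2)`, `1` the other upper bounds, and `2^(d/2) A` the
    -- lower bound.
    set c : ℝ := max (max A₁ 1) (2 ^ ((d : ℝ) / 2) * A) with hcdef
    have hc1 : 1 ≤ c := (le_max_right _ _).trans (le_max_left _ _)
    have hc : 0 < c := by linarith
    have h2d : (1 : ℝ) ≤ 2 ^ ((d : ℝ) / 2) := Real.one_le_rpow (by norm_num) (by positivity)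
    refine ⟨c, 1, 1, (√2)⁻¹, (√2)⁻¹, hc, one_pos, one_pos, hsqrt, hsqrt,
      fun t x ht => ⟨?_, ?_⟩⟩
    · have ht' : (0 : ℝ) < t := ht
      have hB0 : 0 < levyExponentInv μ (t : ℝ)⁻¹ := hμ.levyExponentInv_pos hμ_inf (by positivity)
      have hwin := hμ.quarter_le_measureReal_Icc_inv hμ_inf hlow ht' (hposT t ht) (hlap t)
      rw [← hKdef] at hwin
      set B := levyExponentInv μ (t : ℝ)⁻¹ with hB
      have hK0 : 0 < K := by linarith
      have hρ : 0 < (K * B)⁻¹ := by positivity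
      -- The window `[1/(KB), K/B]` has endpoint ratio `K²`, and adding `t` to both endpoints does
      -- not increase the ratio.
      have hcore := min_le_mul_integral_gaussKernel_add (K := K ^ 2) (hposT t ht) ht' hρ.le
        (by
          have h1 : K ^ 2 * (K * B)⁻¹ = K / B := by field_simp
          have h2 : (t : ℝ) ≤ K ^ 2 * t := le_mul_of_one_le_left ht'.le (one_le_pow₀ hK1)
          linarith) hwin x
      rw [← hA, ← hpt t ht, ← hqt t ht] at hcore
      have hmin := min_rpow_le_mul_rpow_add (k := (d : ℝ) / 2) ht' hB0 hρ
        (inv_anti₀ hB0 (le_mul_of_one_le_left hB0.le hK1)) (by positivity)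
      rw [← neg_div] at hmin
      rw [one_smul, inv_mul_le_iff₀ hc]
      have hG : 0 ≤ gaussKernel t x + q t x := by
        rw [hqt t ht]
        exact add_nonneg (gaussKernel_nonneg ht'.le x) (integral_gaussKernel_nonneg (hposT t ht) x)
      calc min (min ((t : ℝ) ^ (-(d : ℝ) / 2)) (B ^ ((d : ℝ) / 2))) (gaussKernel t x + q t x)
          ≤ min (2 ^ ((d : ℝ) / 2) * (t + (K * B)⁻¹) ^ (-(d : ℝ) / 2))
              (2 ^ ((d : ℝ) / 2) * (gaussKernel t x + q t x)) :=
            min_le_min hmin (le_mul_of_one_le_left hG h2d)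
        _ = 2 ^ ((d : ℝ) / 2) * min ((t + (K * B)⁻¹) ^ (-(d : ℝ) / 2))
              (gaussKernel t x + q t x) := (mul_min_of_nonneg _ _ (by positivity)).symm
        _ ≤ 2 ^ ((d : ℝ) / 2) * (A * p t x) := by gcongr
        _ = 2 ^ ((d : ℝ) / 2) * A * p t x := by ring
        _ ≤ c * p t x := mul_le_mul_of_nonneg_right (le_max_right _ _) (hp0 t ht x)
    · have ht' : (0 : ℝ) < t := ht
      have hB0 : 0 < levyExponentInv μ (t : ℝ)⁻¹ := hμ.levyExponentInv_pos hμ_inf (by positivity)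
      have h3 : p t x ≤ c * levyExponentInv μ (t : ℝ)⁻¹ ^ ((d : ℝ) / 2) := by
        rw [hpt t ht]
        refine (hA₁ _ t ht' (hposT t ht) (hlap t) x).trans ?_
        have : A₁ ≤ c := (le_max_left _ _).trans (le_max_left _ _)
        gcongr
      have hle : ∀ y : ℝ, p t x ≤ y → p t x ≤ c * y := fun y hy =>
        hy.trans (le_mul_of_one_le_left ((hp0 t ht x).trans hy) hc1)
      rw [mul_min_of_nonneg _ _ hc.le, mul_min_of_nonneg _ _ hc.le]
      exact le_min (le_min (hle _ (hup1 t ht x)) h3) (hle _ (hup2 t ht x))
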